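/- Let $U_3=\langle s_1,s_2,s_3\mid s_1^2=s_2^2=s_3^2=1\rangle$ be the universal Coxeter group of rank $3$. Let $V=\mathbb{R}^3$ with basis $\Delta=\{\alpha_1,\alpha_2,\alpha_3\}$ and symmetric bilinear form $\langle\alpha_i,\alpha_i\rangle=1$, $\langle\alpha_i,\alpha_j\rangle=-1$ for $i\neq j$, and let $U_3$ act on $V$ by $s_i\cdot x=x-2\langle\alpha_i,x\rangle\alpha_i$. Let $\Phi=\{w\cdot\alpha_i : w\in U_3,\ 1\le i\le 3\}$ be the set of roots, write $\mathrm{Span}_{\ge0}X$ for the set of nonnegative linear combinations of elements of $X\subseteq V$ (so $\mathrm{Span}_{\ge 0}\varnothing=\{0\}$), and let $\Phi^+=\Phi\cap\mathrm{Span}_{\ge0}\Delta$ be the set of positive roots. A set $R\subseteq\Phi^+$ is closed if $\mathrm{Span}_{\ge0}\{\alpha,\beta\}\cap\Phi^+\subseteq R$ for all $\alpha,\beta\in R$, and biclosed if both $R$ and $\Phi^+\setminus R$ are closed. The extended weak order of $U_3$ is the set of biclosed subsets of $\Phi^+$, partially ordered by containment. Every biclosed set $R\subseteq\Phi^+$ is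 weakly separable, that is, $\mathrm{Span}_{\ge0}R\cap\mathrm{Span}_{\ge0}(\Phi^+\setminus R)=\{0\}$. Moreover, the extended weak order of $U_3$ is a lattice: any two biclosed sets have a least upper bound and a greatest lower bound among the biclosed sets. -/

import Mathlib

/-! The universal Coxeter group of rank `3`, its standard reflection representation and root
system, and the extended weak order. -/

namespace UniversalCoxeter

/-- The Coxeter matrix with all off-diagonal entries infinite (encoded by `0` in Mathlib). -/
def coxeterMatrix : CoxeterMatrix (Fin 3) where
  M := Matrix.of fun i j : Fin 3 => if i = j then 1 else 0
  isSymm := by ext i j; simp [Matrix.transpose_apply, eq_comm]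
  diagonal := by simp
  off_diagonal := by intro i j h; simp [h]

/-- The universal Coxeter group of rank `3`: generators `s 0, s 1, s 2`, relations `(s i)² = 1`. -/
abbrev U3 : Type := coxeterMatrix.Group

/-- The space of the representation; coordinates are those in the basis of simple roots. -/
abbrev V : Type := Fin 3 → ℝ

/-- The simple roots: the standard basis of `V`. -/
def simpleRoot (i : Fin 3) : V := Pi.single i 1

/-- The symmetric bilinear form with `⟨αᵢ, αᵢ⟩ = 1` and `⟨αᵢ, αⱼ⟩ = -1` for `i ≠ j`. -/
noncomputable def form : LinearMap.BilinForm ℝ V :=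
  Matrix.toBilin' (Matrix.of fun i j : Fin 3 => if i = j then (1 : ℝ) else -1)

/-- The reflection `x ↦ x - (2 ⟨v, x⟩ / ⟨v, v⟩) v`, for `v` with `⟨v, v⟩ ≠ 0`. -/
noncomputable def refl (v : V) : Module.End ℝ V :=
  Module.preReflection v ((2 / form v v) • form v)

theorem refl_apply (v x : V) : refl v x = x - (2 * form v x / form v v) • v := by
  simp [refl, Module.preReflection_apply, div_mul_eq_mul_div]

theorem form_simpleRoot (i j : Fin 3) :
    form (simpleRoot i) (simpleRoot j) = if i = j then 1 else -1 := by
  simp [form, simpleRoot, Matrix.toBilin'_single]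

theorem refl_simpleRoot_mul_self (i : Fin 3) :
    refl (simpleRoot i) * refl (simpleRoot i) = 1 := by
  refine LinearMap.ext fun x => ?_
  rw [Module.End.mul_apply, Module.End.one_apply]
  exact Module.involutive_preReflection (by simp [form_simpleRoot]) x

/-- The standard reflection representation, `s i ↦ refl (simpleRoot i)`. -/
noncomputable def rep : U3 →* Module.End ℝ V :=
  coxeterMatrix.toCoxeterSystem.lift ⟨fun i => refl (simpleRoot i), by
    intro i j
    by_cases h : i = j
    · subst h
      simp [refl_simpleRoot_mul_self]
    · simp [coxeterMatrix, h]⟩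

theorem rep_simple (i : Fin 3) : rep (coxeterMatrix.simple i) = refl (simpleRoot i) := by
  rw [← coxeterMatrix.toCoxeterSystem_simple]
  exact coxeterMatrix.toCoxeterSystem.lift_apply_simple _ i

/-- The root system: all vectors `w • αᵢ`. -/
def roots : Set V := {β | ∃ (w : U3) (i : Fin 3), β = rep w (simpleRoot i)}

/-- The nonnegative span: all nonnegative linear combinations of elements of `X`. -/
def nonnegSpan (X : Set V) : Set V := (PointedCone.hull ℝ X : Set V)

/-- The positive roots: the roots in the nonnegative span of the simple roots. -/
def posRoots : Set V := roots ∩ nonnegSpan (Set.range simpleRoot)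

/-- A set of positive roots is closed if it contains every positive root in the nonnegative span
of two of its elements. -/
def IsClosedSet (R : Set V) : Prop :=
  R ⊆ posRoots ∧ ∀ α ∈ R, ∀ β ∈ R, nonnegSpan {α, β} ∩ posRoots ⊆ R

/-- A set of positive roots is biclosed if it and its complement in the positive roots are
closed. -/
def IsBiclosed (R : Set V) : Prop := IsClosedSet R ∧ IsClosedSet (posRoots \ R)

/-- A set of positive roots is weakly separable if its nonnegative span meets that of its
complement in the positive roots only in `0`. -/
def IsWeaklySeparable (R : Set V) : Prop :=
  R ⊆ posRoots ∧ nonnegSpan R ∩ nonnegSpan (posRoots \ R) = {0}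

/-- The extended weak order: the biclosed sets of positive roots, ordered by containment (the
order that a subtype of `Set V` inherits). -/
abbrev ExtendedWeakOrder : Type := {R : Set V // IsBiclosed R}

/-- A partially ordered set is a lattice if any two elements have a least upper bound and a
greatest lower bound. -/
def IsLatticeOrder (P : Type*) [PartialOrder P] : Prop :=
  ∀ a b : P, (∃ j : P, IsLUB {a, b} j) ∧ (∃ m : P, IsGLB {a, b} m)

end UniversalCoxeter

namespace UniversalCoxeter

/-! ### Nonnegative spans -/

/-! Identify `V` with Sym² ℝ². The roots become the products `a * b` of integral vectors with `det2
a b = ±1`, that is, signed edges of the Farey graph; the simple roots are the sides of the triangle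
0, 1, ∞. A linear functional on `V` is the polarization of a binary quadratic form `q`.

Weak separability. Up to complements and permutations of coordinates, a biclosed `R` that is neither
empty nor everything contains exactly one simple root, the edge from 0 to 1. Its edges at each level
of Farey subdivision then form an interval (`levelSet_convex`), hence so do the deep vertices, those
with almost all of their edges in `R`. When this interval has an end and at least two points, `q` is
chosen to change sign at its finite ends. If `q` had the wrong sign on an edge `a * b`, suitable
vertices `s a + t b` and `s a - t b` would have values of opposite signs, so one would be deep and
the other not; but adding multiples of `a * b` carries edges at the second to edges at the first,
against closedness (`sign_of_form`). With at most one deep vertex, or all finite ones deep, `q` is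
plus or minus a square. The resulting weak inequalities suffice, since the kernel of the functional
is a plane, where closedness can be used directly (`separated_of_functional`).

Lattice property. If `A, B ⊆ C, D` are biclosed, the cones of `A ∪ B` and of the union of the
complements of `C` and `D` meet only in `0` (`separated_union`): with three simple roots, either `A`
and `B` share one or the two complements do, and a linear dependency in dimension three excludes a
common vector. Zorn's lemma then interpolates a biclosed set (`exists_isBiclosed_of_separated`), so
the upper bounds of `A, B` are directed downwards, and one more interpolation gives the join. -/

theorem subset_nonnegSpan (X : Set V) : X ⊆ nonnegSpan X := fun _ h => Submodule.subset_span h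

theorem nonnegSpan_mono {X Y : Set V} (h : X ⊆ Y) : nonnegSpan X ⊆ nonnegSpan Y :=
  fun _ hx => Submodule.span_mono h hx

theorem zero_mem_nonnegSpan (X : Set V) : (0 : V) ∈ nonnegSpan X :=
  Submodule.zero_mem (PointedCone.hull ℝ X)

theorem add_mem_nonnegSpan {X : Set V} {x y : V} (hx : x ∈ nonnegSpan X) (hy : y ∈ nonnegSpan X) :
    x + y ∈ nonnegSpan X :=
  Submodule.add_mem (PointedCone.hull ℝ X) hx hy

theorem smul_mem_nonnegSpan {X : Set V} {x : V} {r : ℝ} (hr : 0 ≤ r) (hx : x ∈ nonnegSpan X) :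
    r • x ∈ nonnegSpan X :=
  Submodule.smul_mem (PointedCone.hull ℝ X) ⟨r, hr⟩ hx

theorem nonnegSpan_induction {X : Set V} {p : V → Prop} (mem : ∀ x ∈ X, p x) (zero : p 0)
    (add : ∀ x y, p x → p y → p (x + y)) (smul : ∀ r : ℝ, 0 ≤ r → ∀ x, p x → p (r • x)) :
    ∀ x ∈ nonnegSpan X, p x := by
  intro x hx
  refine Submodule.span_induction (p := fun x _ => p x) mem zero (fun x y _ _ => add x y)
    (fun (r : {c : ℝ // 0 ≤ c}) x _ h => smul r.1 r.2 x h) hx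

theorem nonnegSpan_subset {X Y : Set V} (h : X ⊆ nonnegSpan Y) : nonnegSpan X ⊆ nonnegSpan Y :=
  nonnegSpan_induction h (zero_mem_nonnegSpan Y) (fun _ _ => add_mem_nonnegSpan)
    (fun _ hr _ => smul_mem_nonnegSpan hr)

theorem exists_add_of_mem_nonnegSpan_union {X Y : Set V} {u : V} (hu : u ∈ nonnegSpan (X ∪ Y)) :
    ∃ a ∈ nonnegSpan X, ∃ b ∈ nonnegSpan Y, u = a + b := by
  have : u ∈ Submodule.span _ (X ∪ Y) := hu
  rw [Submodule.span_union, Submodule.mem_sup] at this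
  obtain ⟨a, ha, b, hb, h⟩ := this
  exact ⟨a, ha, b, hb, h.symm⟩

theorem mem_nonnegSpan_pair {a b x : V} {t r s : ℝ} (ht : 0 < t) (hr : 0 ≤ r) (hs : 0 ≤ s)
    (h : t • x = r • a + s • b) : x ∈ nonnegSpan {a, b} := by
  have : x = t⁻¹ • (r • a + s • b) := by rw [← h, smul_smul, inv_mul_cancel₀ ht.ne', one_smul]
  rw [this]
  exact smul_mem_nonnegSpan (inv_nonneg.2 ht.le) (add_mem_nonnegSpan
    (smul_mem_nonnegSpan hr (subset_nonnegSpan _ (by simp)))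
    (smul_mem_nonnegSpan hs (subset_nonnegSpan _ (by simp))))

theorem simpleRoot_apply (i j : Fin 3) : simpleRoot i j = if j = i then 1 else 0 := by
  simp [simpleRoot, Pi.single_apply]

theorem mem_nonnegSpan_simpleRoot {x : V} :
    x ∈ nonnegSpan (Set.range simpleRoot) ↔ ∀ i, 0 ≤ x i := by
  constructor
  · refine nonnegSpan_induction (p := fun x => ∀ i, 0 ≤ x i) ?_ (by simp)
      (fun x y hx hy i => add_nonneg (hx i) (hy i)) (fun r hr x hx i => mul_nonneg hr (hx i)) x
    rintro _ ⟨i, rfl⟩ j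
    rw [simpleRoot_apply]; split_ifs <;> norm_num
  · intro h
    have : x = x 0 • simpleRoot 0 + (x 1 • simpleRoot 1 + x 2 • simpleRoot 2) := by
      ext j; fin_cases j <;> simp [simpleRoot_apply]
    rw [this]
    have key : ∀ i, x i • simpleRoot i ∈ nonnegSpan (Set.range simpleRoot) := fun i =>
      smul_mem_nonnegSpan (h i) (subset_nonnegSpan _ ⟨i, rfl⟩)
    exact add_mem_nonnegSpan (key 0) (add_mem_nonnegSpan (key 1) (key 2))

/-! ### The positive roots in coordinates -/

/-- The integral vector with the given coordinates. -/
def intVec (y : Fin 3 → ℤ) : V := fun i => (y i : ℝ)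

/-- The quadratic form of the representation on integral vectors. -/
def normForm (y : Fin 3 → ℤ) : ℤ :=
  2 * (y 0 ^ 2 + y 1 ^ 2 + y 2 ^ 2) - (y 0 + y 1 + y 2) ^ 2

theorem simpleRoot_mem_roots (i : Fin 3) : simpleRoot i ∈ roots := ⟨1, i, by simp⟩

theorem refl_mem_roots (i : Fin 3) {x : V} (hx : x ∈ roots) : refl (simpleRoot i) x ∈ roots := by
  obtain ⟨w, j, rfl⟩ := hx
  exact ⟨coxeterMatrix.simple i * w, j, by rw [map_mul, rep_simple]; rfl⟩

theorem roots_induction {p : V → Prop} (simple : ∀ i, p (simpleRoot i))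
    (step : ∀ i x, p x → p (refl (simpleRoot i) x)) : ∀ x ∈ roots, p x := by
  rintro _ ⟨w, j, rfl⟩
  refine coxeterMatrix.toCoxeterSystem.simple_induction_left (p := fun w => p (rep w (simpleRoot j)))
    w (by simpa using simple j) ?_
  intro w i h
  have := step i _ h
  rw [← rep_simple, ← Module.End.mul_apply, ← map_mul, ← coxeterMatrix.toCoxeterSystem_simple] at this
  exact this

theorem refl_simpleRoot_apply (i j : Fin 3) (x : V) :
    refl (simpleRoot i) x j =
      if j = i then 2 * (x 0 + x 1 + x 2) - 3 * x i else x j := by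
  rw [refl_apply]
  have : form (simpleRoot i) x = 2 * x i - (x 0 + x 1 + x 2) := by
    simp only [form, Matrix.toBilin'_apply, Fin.sum_univ_three, simpleRoot_apply, Matrix.of_apply]
    fin_cases i <;> simp <;> ring
  rw [this, form_simpleRoot]
  simp only [if_true, Pi.sub_apply, Pi.smul_apply, simpleRoot_apply, smul_eq_mul]
  split_ifs with h
  · subst h; ring
  · ring

/-- For distinct indices, `1 + 4 * (y i * y j)` is a square, so integrality excludes negative
products. One positive coordinate therefore makes all coordinates nonnegative. -/
theorem mul_nonneg_of_normForm_eq_one {y : Fin 3 → ℤ} (h : normForm y = 1) (i j : Fin 3) :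
    0 ≤ y i * y j := by
  unfold normForm at h
  have h01 : 0 ≤ y 0 * y 1 := by
    have : (y 0 + y 1 - y 2) ^ 2 = 1 + 4 * (y 0 * y 1) := by linear_combination h
    have := sq_nonneg (y 0 + y 1 - y 2)
    omega
  have h02 : 0 ≤ y 0 * y 2 := by
    have : (y 0 + y 2 - y 1) ^ 2 = 1 + 4 * (y 0 * y 2) := by linear_combination h
    have := sq_nonneg (y 0 + y 2 - y 1)
    omega
  have h12 : 0 ≤ y 1 * y 2 := by
    have : (y 1 + y 2 - y 0) ^ 2 = 1 + 4 * (y 1 * y 2) := by linear_combination h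
    have := sq_nonneg (y 1 + y 2 - y 0)
    omega
  fin_cases i <;> fin_cases j <;> simp <;>
    first | exact mul_self_nonneg _ | assumption | (rw [mul_comm]; assumption)

/-- A nonnegative integral vector of norm one is a simple root, or some simple reflection makes it
smaller but leaves it nonnegative. -/
theorem normForm_descent {y : Fin 3 → ℤ} (h : normForm y = 1) (hy : ∀ i, 0 ≤ y i) :
    (∃ i, intVec y = simpleRoot i) ∨
      ∃ i, 0 ≤ 2 * (y 0 + y 1 + y 2) - 3 * y i ∧ 2 * (y 0 + y 1 + y 2) - 3 * y i < y i := by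
  have key : ∀ a b c : ℤ, 0 ≤ a → 0 ≤ b → 0 ≤ c → b ≤ a → c ≤ a →
      2 * (a ^ 2 + b ^ 2 + c ^ 2) - (a + b + c) ^ 2 = 1 → (a = 1 ∧ b = 0 ∧ c = 0) ∨
      (0 ≤ 2 * (b + c) - a ∧ 2 * (b + c) - a < a) := by
    intro a b c ha hb hc hba hca h
    -- The equation is quadratic in the largest coordinate `a`. The reflection exchanges its two
    -- solutions `a` and `2 * (b + c) - a`, whose product is `(b - c) ^ 2 - 1`.
    have hprod : a * (2 * (b + c) - a) = (b - c) ^ 2 - 1 := by linear_combination -h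
    have ha0 : 0 < a := by
      rcases ha.eq_or_lt with h0 | h0
      · subst h0
        have : b = 0 := by omega
        have : c = 0 := by omega
        subst b c; norm_num at h
      · exact h0
    by_cases hbc : b = c
    · left
      subst hbc
      have h1 : a * (a - 4 * b) = 1 := by linear_combination -hprod
      have ha1 : a = 1 := by
        rcases Int.eq_one_or_neg_one_of_mul_eq_one h1 with h | h <;> omega
      subst ha1
      omega
    · right
      have h1 : 1 ≤ (b - c) ^ 2 := by
        have : 0 < (b - c) ^ 2 := by have := sub_ne_zero.2 hbc; positivity
        omega
      have h2 : (b - c) ^ 2 ≤ a ^ 2 := by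
        apply sq_le_sq' <;> omega
      constructor
      · by_contra hn
        nlinarith
      · by_contra hn
        nlinarith
  unfold normForm at h
  by_cases h1 : y 1 ≤ y 0 ∧ y 2 ≤ y 0
  · rcases key (y 0) (y 1) (y 2) (hy 0) (hy 1) (hy 2) h1.1 h1.2 (by linear_combination h) with h2 | h2
    · exact Or.inl ⟨0, by ext j; fin_cases j <;> simp [intVec, simpleRoot_apply, h2]⟩
    · exact Or.inr ⟨0, by omega, by omega⟩
  by_cases h1 : y 0 ≤ y 1 ∧ y 2 ≤ y 1
  · rcases key (y 1) (y 0) (y 2) (hy 1) (hy 0) (hy 2) h1.1 h1.2 (by linear_combination h) with h2 | h2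
    · exact Or.inl ⟨1, by ext j; fin_cases j <;> simp [intVec, simpleRoot_apply, h2]⟩
    · exact Or.inr ⟨1, by omega, by omega⟩
  · rcases key (y 2) (y 0) (y 1) (hy 2) (hy 0) (hy 1) (by omega) (by omega)
      (by linear_combination h) with h2 | h2
    · exact Or.inl ⟨2, by ext j; fin_cases j <;> simp [intVec, simpleRoot_apply, h2]⟩
    · exact Or.inr ⟨2, by omega, by omega⟩

theorem refl_simpleRoot_intVec (i : Fin 3) (y : Fin 3 → ℤ) :
    refl (simpleRoot i) (intVec y) =
      intVec (Function.update y i (2 * (y 0 + y 1 + y 2) - 3 * y i)) := by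
  ext j
  rw [refl_simpleRoot_apply]
  by_cases h : j = i
  · subst h; simp [intVec]
  · simp [intVec, h]

theorem normForm_reflect (i : Fin 3) (y : Fin 3 → ℤ) :
    normForm (Function.update y i (2 * (y 0 + y 1 + y 2) - 3 * y i)) = normForm y := by
  fin_cases i <;> simp [normForm, Function.update] <;> ring

theorem exists_intVec_of_mem_roots {x : V} (hx : x ∈ roots) :
    ∃ y, normForm y = 1 ∧ x = intVec y := by
  refine roots_induction (p := fun x => ∃ y, normForm y = 1 ∧ x = intVec y) ?_ ?_ x hx
  · intro i
    refine ⟨Pi.single i 1, ?_, ?_⟩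
    · fin_cases i <;> simp [normForm]
    · ext j; simp [intVec, simpleRoot_apply, Pi.single_apply]
  · rintro i _ ⟨y, hy, rfl⟩
    exact ⟨_, (normForm_reflect i y).trans hy, refl_simpleRoot_intVec i y⟩

/-- Induction over the nonnegative integral vectors of norm one: every such vector that is not a
simple root is `z + c αᵢ` with `c ≥ 0` and `z = sᵢ y` smaller. -/
theorem normForm_induction {p : V → Prop} (simple : ∀ i, p (simpleRoot i))
    (step : ∀ (i : Fin 3) (y z : Fin 3 → ℤ) (c : ℝ), normForm y = 1 → (∀ i, 0 ≤ y i) →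
      intVec y = refl (simpleRoot i) (intVec z) → 0 ≤ c →
      intVec y = intVec z + c • simpleRoot i → p (intVec z) → p (intVec y))
    (y : Fin 3 → ℤ) (h : normForm y = 1) (hy : ∀ i, 0 ≤ y i) : p (intVec y) := by
  induction hn : (y 0 + y 1 + y 2).toNat using Nat.strong_induction_on generalizing y with
  | _ n ih =>
  rcases normForm_descent h hy with ⟨i, hi⟩ | ⟨i, hi0, hi1⟩
  · rw [hi]; exact simple i
  · set z := Function.update y i (2 * (y 0 + y 1 + y 2) - 3 * y i) with hz
    have hz1 : normForm z = 1 := (normForm_reflect i y).trans h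
    have hz0 : ∀ j, 0 ≤ z j := by
      intro j
      by_cases hj : j = i
      · subst hj; simpa [hz] using hi0
      · simpa [hz, hj] using hy j
    have hlt : z 0 + z 1 + z 2 < y 0 + y 1 + y 2 := by
      fin_cases i <;> simp [hz] at hi1 ⊢ <;> omega
    have hzr : intVec z = refl (simpleRoot i) (intVec y) := (refl_simpleRoot_intVec i y).symm
    refine step i y z (y i - z i) h hy ?_ ?_ ?_ (ih _ ?_ z hz1 hz0 rfl)
    · rw [hzr, ← Module.End.mul_apply, refl_simpleRoot_mul_self, Module.End.one_apply]
    · have : z i < y i := by simpa [hz] using hi1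
      have : (z i : ℝ) < y i := by exact_mod_cast this
      linarith
    · ext j
      by_cases hj : j = i
      · subst hj; simp [intVec, simpleRoot_apply]
      · simp [intVec, simpleRoot_apply, hj, hz]
    · have := hz0 0; have := hz0 1; have := hz0 2
      omega

theorem mem_posRoots_iff {x : V} :
    x ∈ posRoots ↔ ∃ y, normForm y = 1 ∧ (∀ i, 0 ≤ y i) ∧ x = intVec y := by
  constructor
  · rintro ⟨h1, h2⟩
    obtain ⟨y, hy, rfl⟩ := exists_intVec_of_mem_roots h1
    exact ⟨y, hy, fun i => by simpa [intVec] using mem_nonnegSpan_simpleRoot.1 h2 i, rfl⟩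
  · rintro ⟨y, hy, hy0, rfl⟩
    refine ⟨?_, mem_nonnegSpan_simpleRoot.2 fun i => by simpa [intVec] using hy0 i⟩
    refine normForm_induction (p := (· ∈ roots)) simpleRoot_mem_roots ?_ y hy hy0
    intro i y z _ _ _ hr _ _ hz
    rw [hr]; exact refl_mem_roots i hz

theorem simpleRoot_mem_posRoots (i : Fin 3) : simpleRoot i ∈ posRoots :=
  ⟨simpleRoot_mem_roots i, subset_nonnegSpan _ ⟨i, rfl⟩⟩

theorem nonneg_of_mem_posRoots {x : V} (hx : x ∈ posRoots) (i : Fin 3) : 0 ≤ x i :=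
  mem_nonnegSpan_simpleRoot.1 hx.2 i

theorem ne_zero_of_mem_posRoots {x : V} (hx : x ∈ posRoots) : x ≠ 0 := by
  obtain ⟨y, hy, _, rfl⟩ := mem_posRoots_iff.1 hx
  intro h
  have : ∀ i, y i = 0 := fun i => by
    have := congrFun h i
    simpa [intVec] using this
  simp [normForm, this] at hy

theorem nonneg_of_mem_nonnegSpan {X : Set V} (hX : X ⊆ posRoots) {x : V} (hx : x ∈ nonnegSpan X)
    (i : Fin 3) : 0 ≤ x i :=
  mem_nonnegSpan_simpleRoot.1
    (nonnegSpan_subset (fun _ h => (hX h).2) hx) i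

theorem eq_zero_of_add_eq_zero {x y : V} (hx : ∀ i, 0 ≤ x i) (hy : ∀ i, 0 ≤ y i)
    (h : x + y = 0) : x = 0 := by
  ext i
  have := congrFun h i
  have h1 := hx i
  have h2 := hy i
  simp at this ⊢
  linarith

/-! ### Closed and biclosed sets -/

theorem IsClosedSet.mem {R : Set V} (hR : IsClosedSet R) {a b x : V} (ha : a ∈ R) (hb : b ∈ R)
    (hx : x ∈ posRoots) {t r s : ℝ} (ht : 0 < t) (hr : 0 ≤ r) (hs : 0 ≤ s)
    (h : t • x = r • a + s • b) : x ∈ R :=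
  hR.2 a ha b hb ⟨mem_nonnegSpan_pair ht hr hs h, hx⟩

theorem IsBiclosed.subset {R : Set V} (hR : IsBiclosed R) : R ⊆ posRoots := hR.1.1

theorem IsBiclosed.compl {R : Set V} (hR : IsBiclosed R) : IsBiclosed (posRoots \ R) :=
  ⟨hR.2, by rw [Set.sdiff_sdiff_cancel_left hR.1.1]; exact hR.1⟩

theorem isBiclosed_posRoots : IsBiclosed posRoots :=
  ⟨⟨subset_rfl, fun _ _ _ _ _ hx => hx.2⟩, by simp [IsClosedSet]⟩

theorem isBiclosed_of_inter_subset {R : Set V} (hR : R ⊆ posRoots)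
    (h : nonnegSpan R ∩ nonnegSpan (posRoots \ R) ⊆ {0}) : IsBiclosed R := by
  refine ⟨⟨hR, ?_⟩, Set.sdiff_subset, ?_⟩
  · rintro a ha b hb x ⟨hx, hxp⟩
    by_contra hxR
    exact ne_zero_of_mem_posRoots hxp (h ⟨nonnegSpan_mono (Set.pair_subset ha hb) hx,
      subset_nonnegSpan _ ⟨hxp, hxR⟩⟩)
  · rintro a ha b hb x ⟨hx, hxp⟩
    refine ⟨hxp, fun hxR => ?_⟩
    exact ne_zero_of_mem_posRoots hxp (h ⟨subset_nonnegSpan _ hxR,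
      nonnegSpan_mono (Set.pair_subset ha hb) hx⟩)

/-- A closed set containing the simple roots contains all positive roots. -/
theorem IsClosedSet.posRoots_subset {R : Set V} (hR : IsClosedSet R)
    (h : ∀ i, simpleRoot i ∈ R) : posRoots ⊆ R := by
  intro x hx
  obtain ⟨y, hy, hy0, rfl⟩ := mem_posRoots_iff.1 hx
  refine normForm_induction (p := (· ∈ R)) h ?_ y hy hy0
  intro i y z c hy hy0 _ hc hyz hz
  exact hR.mem hz (h i) (mem_posRoots_iff.2 ⟨y, hy, hy0, rfl⟩) one_pos zero_le_one hc (by simpa using hyz)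

end UniversalCoxeter

namespace UniversalCoxeter

/-! ### Extending separated pairs -/

theorem mem_nonnegSpan_singleton {g x : V} (hx : x ∈ nonnegSpan {g}) : ∃ r : ℝ, 0 ≤ r ∧ x = r • g := by
  refine nonnegSpan_induction (p := fun x => ∃ r : ℝ, 0 ≤ r ∧ x = r • g) ?_ ⟨0, le_rfl, by simp⟩
    ?_ ?_ x hx
  · rintro _ rfl; exact ⟨1, zero_le_one, by simp⟩
  · rintro _ _ ⟨r, hr, rfl⟩ ⟨s, hs, rfl⟩; exact ⟨r + s, add_nonneg hr hs, (add_smul _ _ _).symm⟩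
  · rintro t ht _ ⟨r, hr, rfl⟩; exact ⟨t * r, mul_nonneg ht hr, (mul_smul _ _ _).symm⟩

theorem exists_mem_nonnegSpan_of_directedOn {𝒞 : Set (Set V)} (hne : 𝒞.Nonempty)
    (hd : DirectedOn (· ⊆ ·) 𝒞) {u : V} (hu : u ∈ nonnegSpan (⋃₀ 𝒞)) :
    ∃ C ∈ 𝒞, u ∈ nonnegSpan C := by
  refine nonnegSpan_induction (p := fun u => ∃ C ∈ 𝒞, u ∈ nonnegSpan C) ?_ ?_ ?_ ?_ u hu
  · rintro x ⟨C, hC, hx⟩; exact ⟨C, hC, subset_nonnegSpan _ hx⟩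
  · obtain ⟨C, hC⟩ := hne; exact ⟨C, hC, zero_mem_nonnegSpan C⟩
  · rintro x y ⟨C, hC, hx⟩ ⟨D, hD, hy⟩
    obtain ⟨E, hE, hCE, hDE⟩ := hd C hC D hD
    exact ⟨E, hE, add_mem_nonnegSpan (nonnegSpan_mono hCE hx) (nonnegSpan_mono hDE hy)⟩
  · rintro r hr x ⟨C, hC, hx⟩; exact ⟨C, hC, smul_mem_nonnegSpan hr hx⟩

/-- Two sets of positive roots whose nonnegative spans meet only in `0` are separated by a biclosed
set. -/
theorem exists_isBiclosed_of_separated {P N : Set V} (hP : P ⊆ posRoots) (hN : N ⊆ posRoots)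
    (h : nonnegSpan P ∩ nonnegSpan N ⊆ {0}) :
    ∃ E, IsBiclosed E ∧ P ⊆ E ∧ N ⊆ posRoots \ E := by
  obtain ⟨E, hPE, hE⟩ := zorn_subset_nonempty
    {X : Set V | X ⊆ posRoots ∧ nonnegSpan X ∩ nonnegSpan N ⊆ {0}} (by
      intro c hc hchain hne
      refine ⟨⋃₀ c, ⟨Set.sUnion_subset fun s hs => (hc hs).1, ?_⟩,
        fun s hs => Set.subset_sUnion_of_mem hs⟩
      rintro x ⟨hx, hxN⟩
      obtain ⟨s, hs, hxs⟩ := exists_mem_nonnegSpan_of_directedOn hne hchain.directedOn hx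
      exact (hc hs).2 ⟨hxs, hxN⟩) P ⟨hP, h⟩
  obtain ⟨⟨hEp, hEN⟩, hmax⟩ := hE
  -- By maximality, adjoining `g` creates a common vector `r • g + p` that is nonzero. Here `r > 0`
  -- since `E` itself is separated from `N`, so one may rescale to `r = 1`.
  have key : ∀ g ∈ posRoots \ E, ∃ p ∈ nonnegSpan E, g + p ∈ nonnegSpan N := by
    rintro g ⟨hg, hgE⟩
    by_contra hcon
    push Not at hcon
    refine hgE (hmax (y := insert g E) ⟨Set.insert_subset hg hEp, ?_⟩ (Set.subset_insert g E)
      (Set.mem_insert g E))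
    rintro x ⟨hx, hxN⟩
    rw [Set.insert_eq] at hx
    obtain ⟨a, ha, p, hp, rfl⟩ := exists_add_of_mem_nonnegSpan_union hx
    obtain ⟨r, hr, rfl⟩ := mem_nonnegSpan_singleton ha
    rcases hr.eq_or_lt with rfl | hr
    · simp only [zero_smul, zero_add] at hxN ⊢
      exact hEN ⟨hp, hxN⟩
    · refine absurd ?_ (hcon (r⁻¹ • p) (smul_mem_nonnegSpan (inv_nonneg.2 hr.le) hp))
      have := smul_mem_nonnegSpan (inv_nonneg.2 hr.le) hxN
      rwa [smul_add, smul_smul, inv_mul_cancel₀ hr.ne', one_smul] at this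
  have key' : ∀ x ∈ nonnegSpan (posRoots \ E), ∃ p ∈ nonnegSpan E, x + p ∈ nonnegSpan N := by
    refine nonnegSpan_induction key ⟨0, zero_mem_nonnegSpan _, by simpa using zero_mem_nonnegSpan _⟩
      ?_ ?_
    · rintro x y ⟨p, hp, hxp⟩ ⟨q, hq, hyq⟩
      refine ⟨p + q, add_mem_nonnegSpan hp hq, ?_⟩
      rw [add_add_add_comm]
      exact add_mem_nonnegSpan hxp hyq
    · rintro r hr x ⟨p, hp, hxp⟩
      exact ⟨r • p, smul_mem_nonnegSpan hr hp, by rw [← smul_add]; exact smul_mem_nonnegSpan hr hxp⟩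
  refine ⟨E, isBiclosed_of_inter_subset hEp ?_, hPE, fun x hx => ⟨hN hx, fun hxE => ?_⟩⟩
  -- Here `x + p` lies in the cones of both `E` and `N`, so it vanishes, and nonnegative coordinates
  -- give `x = 0`.
  · rintro x ⟨hx, hx'⟩
    obtain ⟨p, hp, hxp⟩ := key' x hx'
    exact eq_zero_of_add_eq_zero (nonneg_of_mem_nonnegSpan hEp hx)
      (nonneg_of_mem_nonnegSpan hEp hp) (hEN ⟨add_mem_nonnegSpan hx hp, hxp⟩)
  · exact ne_zero_of_mem_posRoots (hN hx)
      (hEN ⟨subset_nonnegSpan _ hxE, subset_nonnegSpan _ hx⟩)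

/-! ### Interpolation between biclosed sets -/

theorem eq_zero_of_smul_add {x y : V} {r : ℝ} (hr : 0 < r) (hx : ∀ i, 0 ≤ x i) (hy : ∀ i, 0 ≤ y i)
    (h : r • x + y = 0) : x = 0 := by
  have := eq_zero_of_add_eq_zero (x := r • x) (fun i => mul_nonneg hr.le (hx i)) hy h
  simpa [hr.ne'] using this

theorem exists_nontrivial_relation (x a b c : V) :
    ∃ m p q r : ℝ, 0 ≤ m ∧ (m ≠ 0 ∨ p ≠ 0 ∨ q ≠ 0 ∨ r ≠ 0) ∧ m • x = p • a + q • b + r • c := by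
  have hdep : ¬ LinearIndependent ℝ ![x, a, b, c] := by
    intro h
    have := h.fintype_card_le_finrank
    simp at this
  rw [Fintype.not_linearIndependent_iff] at hdep
  obtain ⟨g, hg, i, hi⟩ := hdep
  simp only [Fin.sum_univ_four, Matrix.cons_val] at hg
  have hnz : g 0 ≠ 0 ∨ g 1 ≠ 0 ∨ g 2 ≠ 0 ∨ g 3 ≠ 0 := by
    fin_cases i <;> simp_all
  rcases le_total 0 (g 0) with h0 | h0
  · refine ⟨g 0, -g 1, -g 2, -g 3, h0, by simpa using hnz, ?_⟩
    rw [← sub_eq_zero, ← hg]; module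
  · refine ⟨-g 0, g 1, g 2, g 3, by linarith, by simpa using hnz, ?_⟩
    rw [← sub_eq_zero, ← neg_eq_zero, ← hg]; module

/-- If `p < 0`, separation at `C`, or nonnegativity of coordinates when `r < 0`, forces `a = 0`. If
`p + r < 0 ≤ p`, eliminating `c` in favour of `d` gives the same by separation at `D`. Otherwise
eliminating `a` puts one vector in the cones of `B` and of its complement, and every coefficient
vanishes. -/
theorem crossing_relation_trivial {B C D : Set V} (hB : nonnegSpan B ∩ nonnegSpan (posRoots \ B) ⊆ {0})
    (hC : nonnegSpan C ∩ nonnegSpan (posRoots \ C) ⊆ {0})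
    (hD : nonnegSpan D ∩ nonnegSpan (posRoots \ D) ⊆ {0}) (hCp : C ⊆ posRoots)
    {x a b c d : V} (hxB : x ∈ nonnegSpan B) (hxC : x ∈ nonnegSpan C) (hxD : x ∈ nonnegSpan D)
    (haC : a ∈ nonnegSpan C) (haD : a ∈ nonnegSpan D)
    (hbB : b ∈ nonnegSpan B) (hbC : b ∈ nonnegSpan C) (hbD : b ∈ nonnegSpan D)
    (hcC : c ∈ nonnegSpan (posRoots \ C)) (hcB : c ∈ nonnegSpan (posRoots \ B))
    (hdD : d ∈ nonnegSpan (posRoots \ D)) (hdB : d ∈ nonnegSpan (posRoots \ B))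
    (h : a + b = c + d) (hx0 : x ≠ 0) (ha0 : a ≠ 0) (hb0 : b ≠ 0) (hc0 : c ≠ 0) (hd0 : d ≠ 0)
    {m p q r : ℝ} (hm : 0 ≤ m) (hpq : q ≤ p) (hrel : m • x = p • a + q • b + r • c) :
    m = 0 ∧ p = 0 ∧ q = 0 ∧ r = 0 := by
  have nn : ∀ {v}, v ∈ nonnegSpan C → ∀ i, 0 ≤ v i := fun hv => nonneg_of_mem_nonnegSpan hCp hv
  have nnc : ∀ {R v}, v ∈ nonnegSpan (posRoots \ R) → ∀ i, 0 ≤ v i :=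
    fun hv => nonneg_of_mem_nonnegSpan Set.sdiff_subset hv
  rcases lt_or_ge p 0 with hp | hp
  · exfalso
    have e : (-p) • a + (m • x + (-q) • b) = r • c := by rw [hrel]; module
    have hmem : m • x + (-q) • b ∈ nonnegSpan C :=
      add_mem_nonnegSpan (smul_mem_nonnegSpan hm hxC) (smul_mem_nonnegSpan (by linarith) hbC)
    rcases lt_or_ge r 0 with hr | hr
    · refine ha0 (eq_zero_of_smul_add (r := -p) (by linarith) (nn haC)
        (y := (m • x + (-q) • b) + (-r) • c) (fun i => add_nonneg (nn hmem i)
          (mul_nonneg (by linarith) (nnc hcC i))) ?_)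
      rw [← add_assoc, e]; module
    · refine ha0 (eq_zero_of_smul_add (r := -p) (by linarith) (nn haC) (nn hmem) ?_)
      refine hC ⟨add_mem_nonnegSpan (smul_mem_nonnegSpan (by linarith) haC) hmem, ?_⟩
      rw [e]; exact smul_mem_nonnegSpan hr hcC
  rcases lt_or_ge (p + r) 0 with hpr | hpr
  · exfalso
    have hd : d = a + b - c := by rw [h]; abel
    have e : (-(p + r)) • a + (m • x + (-(q + r)) • b) = (-r) • d := by rw [hrel, hd]; module
    have hmem : m • x + (-(q + r)) • b ∈ nonnegSpan D :=
      add_mem_nonnegSpan (smul_mem_nonnegSpan hm hxD) (smul_mem_nonnegSpan (by linarith) hbD)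
    have hmem' : m • x + (-(q + r)) • b ∈ nonnegSpan C :=
      add_mem_nonnegSpan (smul_mem_nonnegSpan hm hxC) (smul_mem_nonnegSpan (by linarith) hbC)
    refine ha0 (eq_zero_of_smul_add (r := -(p + r)) (by linarith) (nn haC) (nn hmem') ?_)
    refine hD ⟨add_mem_nonnegSpan (smul_mem_nonnegSpan (by linarith) haD) hmem, ?_⟩
    rw [e]; exact smul_mem_nonnegSpan (by linarith) hdD
  · have ha : a = c + d - b := by rw [← h]; abel
    have e : m • x + (p - q) • b = (p + r) • c + p • d := by rw [hrel, ha]; module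
    have h1 : m • x + (p - q) • b = 0 := by
      refine hB ⟨add_mem_nonnegSpan (smul_mem_nonnegSpan hm hxB)
        (smul_mem_nonnegSpan (by linarith) hbB), ?_⟩
      rw [e]
      exact add_mem_nonnegSpan (smul_mem_nonnegSpan hpr hcB) (smul_mem_nonnegSpan hp hdB)
    have hm0 : m = 0 := by
      by_contra hne
      exact hx0 (eq_zero_of_smul_add (lt_of_le_of_ne hm (Ne.symm hne)) (nn hxC)
        (fun i => mul_nonneg (by linarith) (nn hbC i)) h1)
    have hpq0 : p - q = 0 := by
      by_contra hne
      rw [add_comm] at h1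
      exact hb0 (eq_zero_of_smul_add (lt_of_le_of_ne (by linarith) (Ne.symm hne)) (nn hbC)
        (fun i => mul_nonneg hm (nn hxC i)) h1)
    rw [h1] at e
    have hp0 : p = 0 := by
      by_contra hne
      rw [add_comm] at e
      exact hd0 (eq_zero_of_smul_add (lt_of_le_of_ne hp (Ne.symm hne)) (nnc hdD)
        (fun i => mul_nonneg hpr (nnc hcC i)) e.symm)
    have hr0 : p + r = 0 := by
      by_contra hne
      exact hc0 (eq_zero_of_smul_add (lt_of_le_of_ne hpr (Ne.symm hne)) (nnc hcC)
        (fun i => mul_nonneg hp (nnc hdD i)) e.symm)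
    exact ⟨hm0, hp0, by linarith, by linarith⟩

/-- Otherwise the complement contains all simple roots, and its cone is the whole orthant. -/
theorem exists_simpleRoot_mem {A : Set V} (hAp : A ⊆ posRoots)
    (hA : nonnegSpan A ∩ nonnegSpan (posRoots \ A) ⊆ {0}) {a : V}
    (ha : a ∈ nonnegSpan A) (ha0 : a ≠ 0) : ∃ i, simpleRoot i ∈ A := by
  by_contra hcon
  push Not at hcon
  refine ha0 (hA ⟨ha, nonnegSpan_mono ?_ (mem_nonnegSpan_simpleRoot.2
    (nonneg_of_mem_nonnegSpan hAp ha))⟩)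
  rintro _ ⟨i, rfl⟩
  exact ⟨simpleRoot_mem_posRoots i, hcon i⟩

/-- Four vectors `x, a, b, c` in dimension three are dependent, while `crossing_relation_trivial`
allows no dependency. Exchanging `A` and `B` settles the order of the coefficients of `a` and `b`,
which is why `x` must lie in both sets. -/
theorem no_crossing_of_common_simpleRoot
    (hW : ∀ R, IsBiclosed R → nonnegSpan R ∩ nonnegSpan (posRoots \ R) ⊆ {0}) {A B C D : Set V} (hA : IsBiclosed A) (hB : IsBiclosed B)
    (hC : IsBiclosed C) (hD : IsBiclosed D) (hAC : A ⊆ C) (hAD : A ⊆ D) (hBC : B ⊆ C) (hBD : B ⊆ D)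
    {x a b c d : V} (hxA : x ∈ A) (hxB : x ∈ B)
    (ha : a ∈ nonnegSpan A) (hb : b ∈ nonnegSpan B) (hc : c ∈ nonnegSpan (posRoots \ C))
    (hd : d ∈ nonnegSpan (posRoots \ D)) (h : a + b = c + d)
    (ha0 : a ≠ 0) (hb0 : b ≠ 0) (hc0 : c ≠ 0) (hd0 : d ≠ 0) : False := by
  have hx0 := ne_zero_of_mem_posRoots (hA.subset hxA)
  have mono : ∀ {X Y : Set V}, X ⊆ Y → nonnegSpan (posRoots \ Y) ⊆ nonnegSpan (posRoots \ X) :=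
    fun h => nonnegSpan_mono (Set.sdiff_subset_sdiff_right h)
  obtain ⟨m, p, q, r, hm, hne, hrel⟩ := exists_nontrivial_relation x a b c
  have : m = 0 ∧ p = 0 ∧ q = 0 ∧ r = 0 := by
    rcases le_total q p with hpq | hpq
    · exact crossing_relation_trivial (hW B hB) (hW C hC) (hW D hD) hC.subset
        (subset_nonnegSpan _ hxB) (subset_nonnegSpan _ (hAC hxA)) (subset_nonnegSpan _ (hAD hxA))
        (nonnegSpan_mono hAC ha) (nonnegSpan_mono hAD ha) hb (nonnegSpan_mono hBC hb)
        (nonnegSpan_mono hBD hb) hc (mono hBC hc) hd (mono hBD hd) h hx0 ha0 hb0 hc0 hd0 hm hpq hrel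
    · have := crossing_relation_trivial (hW A hA) (hW C hC) (hW D hD) hC.subset
        (subset_nonnegSpan _ hxA) (subset_nonnegSpan _ (hAC hxA)) (subset_nonnegSpan _ (hAD hxA))
        (nonnegSpan_mono hBC hb) (nonnegSpan_mono hBD hb) ha (nonnegSpan_mono hAC ha)
        (nonnegSpan_mono hAD ha) hc (mono hAC hc) hd (mono hAD hd) ((add_comm _ _).trans h)
        hx0 hb0 ha0 hc0 hd0 hm hpq (by rw [hrel]; module)
      tauto
  tauto

/-- Each of `A`, `B` and the complements of `C`, `D` contains a simple root, and those of the first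
two differ from those of the last two. Among three simple roots this forces a coincidence on one
side, and passing to complements exchanges the sides. -/
theorem separated_union
    (hW : ∀ R, IsBiclosed R → nonnegSpan R ∩ nonnegSpan (posRoots \ R) ⊆ {0}) {A B C D : Set V} (hA : IsBiclosed A) (hB : IsBiclosed B)
    (hC : IsBiclosed C) (hD : IsBiclosed D) (hAC : A ⊆ C) (hAD : A ⊆ D) (hBC : B ⊆ C)
    (hBD : B ⊆ D) :
    nonnegSpan (A ∪ B) ∩ nonnegSpan ((posRoots \ C) ∪ (posRoots \ D)) ⊆ {0} := by
  rintro u ⟨hu, hu'⟩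
  obtain ⟨a, ha, b, hb, rfl⟩ := exists_add_of_mem_nonnegSpan_union hu
  obtain ⟨c, hc, d, hd, h⟩ := exists_add_of_mem_nonnegSpan_union hu'
  by_contra hu0
  replace hu0 : a + b ≠ 0 := hu0
  have mono : ∀ {X Y : Set V}, X ⊆ Y → nonnegSpan (posRoots \ Y) ⊆ nonnegSpan (posRoots \ X) :=
    fun h => nonnegSpan_mono (Set.sdiff_subset_sdiff_right h)
  have ha0 : a ≠ 0 := by
    rintro rfl
    rw [zero_add] at h hu0
    exact hu0 (hW B hB ⟨hb, by rw [h]; exact add_mem_nonnegSpan (mono hBC hc) (mono hBD hd)⟩)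
  have hb0 : b ≠ 0 := by
    rintro rfl
    rw [add_zero] at h hu0
    exact hu0 (hW A hA ⟨ha, by rw [h]; exact add_mem_nonnegSpan (mono hAC hc) (mono hAD hd)⟩)
  have hc0 : c ≠ 0 := by
    rintro rfl
    rw [zero_add] at h
    exact hu0 (hW D hD ⟨add_mem_nonnegSpan (nonnegSpan_mono hAD ha) (nonnegSpan_mono hBD hb),
      by rw [h]; exact hd⟩)
  have hd0 : d ≠ 0 := by
    rintro rfl
    rw [add_zero] at h
    exact hu0 (hW C hC ⟨add_mem_nonnegSpan (nonnegSpan_mono hAC ha) (nonnegSpan_mono hBC hb),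
      by rw [h]; exact hc⟩)
  obtain ⟨i, hi⟩ := exists_simpleRoot_mem hA.subset (hW A hA) ha ha0
  obtain ⟨j, hj⟩ := exists_simpleRoot_mem hB.subset (hW B hB) hb hb0
  obtain ⟨k, hk⟩ := exists_simpleRoot_mem hC.compl.subset (hW _ hC.compl) hc hc0
  obtain ⟨l, hl⟩ := exists_simpleRoot_mem hD.compl.subset (hW _ hD.compl) hd hd0
  have hcases : i = j ∨ k = l := by
    have hik : i ≠ k := by rintro rfl; exact hk.2 (hAC hi)
    have hil : i ≠ l := by rintro rfl; exact hl.2 (hAD hi)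
    have hjk : j ≠ k := by rintro rfl; exact hk.2 (hBC hj)
    have hjl : j ≠ l := by rintro rfl; exact hl.2 (hBD hj)
    clear * - hik hil hjk hjl
    omega
  rcases hcases with rfl | rfl
  · exact no_crossing_of_common_simpleRoot hW hA hB hC hD hAC hAD hBC hBD hi hj ha hb hc hd h
      ha0 hb0 hc0 hd0
  · have hcc : ∀ {X : Set V}, IsBiclosed X → posRoots \ (posRoots \ X) = X :=
      fun hX => Set.sdiff_sdiff_cancel_left hX.subset
    exact no_crossing_of_common_simpleRoot hW hC.compl hD.compl hA.compl hB.compl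
      (Set.sdiff_subset_sdiff_right hAC) (Set.sdiff_subset_sdiff_right hBC)
      (Set.sdiff_subset_sdiff_right hAD) (Set.sdiff_subset_sdiff_right hBD) hk hl hc hd
      (by rwa [hcc hA]) (by rwa [hcc hB]) h.symm hc0 hd0 ha0 hb0

/-- Any two biclosed sets have a least biclosed upper bound. -/
theorem exists_least_isBiclosed
    (hW : ∀ R, IsBiclosed R → nonnegSpan R ∩ nonnegSpan (posRoots \ R) ⊆ {0}) {A B : Set V} (hA : IsBiclosed A) (hB : IsBiclosed B) :
    ∃ E, IsBiclosed E ∧ A ⊆ E ∧ B ⊆ E ∧ ∀ C, IsBiclosed C → A ⊆ C → B ⊆ C → E ⊆ C := by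
  set 𝒞 : Set (Set V) := {X | ∃ C, IsBiclosed C ∧ A ⊆ C ∧ B ⊆ C ∧ X = posRoots \ C} with h𝒞
  have hne : 𝒞.Nonempty := ⟨_, posRoots, isBiclosed_posRoots, hA.subset, hB.subset, rfl⟩
  -- A biclosed set interpolated below `C` and `D` makes the complements of upper bounds directed,
  -- so a vector in the cone of their union already lies in the cone of one of them.
  have hdir : DirectedOn (· ⊆ ·) 𝒞 := by
    rintro _ ⟨C, hC, hAC, hBC, rfl⟩ _ ⟨D, hD, hAD, hBD, rfl⟩
    obtain ⟨E, hE, hPE, hNE⟩ := exists_isBiclosed_of_separated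
      (Set.union_subset hA.subset hB.subset) (Set.union_subset Set.sdiff_subset Set.sdiff_subset)
      (separated_union hW hA hB hC hD hAC hAD hBC hBD)
    exact ⟨posRoots \ E, ⟨E, hE, Set.subset_union_left.trans hPE,
      Set.subset_union_right.trans hPE, rfl⟩, Set.subset_union_left.trans hNE,
      Set.subset_union_right.trans hNE⟩
  have hsub : ⋃₀ 𝒞 ⊆ posRoots := by
    rintro x ⟨_, ⟨C, _, _, _, rfl⟩, hx⟩; exact hx.1
  obtain ⟨E, hE, hPE, hNE⟩ := exists_isBiclosed_of_separated (P := A ∪ B) (N := ⋃₀ 𝒞)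
    (Set.union_subset hA.subset hB.subset) hsub (by
      rintro u ⟨hu, hu'⟩
      obtain ⟨_, ⟨C, hC, hAC, hBC, rfl⟩, huC⟩ :=
        exists_mem_nonnegSpan_of_directedOn hne hdir hu'
      exact hW C hC ⟨nonnegSpan_mono (Set.union_subset hAC hBC) hu, huC⟩)
  refine ⟨E, hE, Set.subset_union_left.trans hPE, Set.subset_union_right.trans hPE, ?_⟩
  intro C hC hAC hBC x hx
  by_contra hxC
  exact (hNE ⟨_, ⟨C, hC, hAC, hBC, rfl⟩, hE.subset hx, hxC⟩).2 hx

/-! ### The lattice property, given weak separability. -/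

theorem isLatticeOrder_extendedWeakOrder
    (hW : ∀ R, IsBiclosed R → nonnegSpan R ∩ nonnegSpan (posRoots \ R) ⊆ {0}) :
    IsLatticeOrder ExtendedWeakOrder := by
  rintro ⟨A, hA⟩ ⟨B, hB⟩
  constructor
  · obtain ⟨E, hE, hAE, hBE, hleast⟩ := exists_least_isBiclosed hW hA hB
    refine ⟨⟨E, hE⟩, ?_, ?_⟩
    · rintro _ (rfl | rfl)
      exacts [hAE, hBE]
    · rintro ⟨C, hC⟩ h
      exact hleast C hC (h (Set.mem_insert _ _)) (h (Set.mem_insert_of_mem _ rfl))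
  · obtain ⟨E, hE, hAE, hBE, hleast⟩ := exists_least_isBiclosed hW hA.compl hB.compl
    refine ⟨⟨posRoots \ E, hE.compl⟩, ?_, ?_⟩
    · rintro _ (rfl | rfl)
      · exact fun x hx => by_contra fun hxA => hx.2 (hAE ⟨hx.1, hxA⟩)
      · exact fun x hx => by_contra fun hxB => hx.2 (hBE ⟨hx.1, hxB⟩)
    · rintro ⟨C, hC⟩ h x hx
      have hCA : C ⊆ A := h (Set.mem_insert _ _)
      have hCB : C ⊆ B := h (Set.mem_insert_of_mem _ rfl)
      refine ⟨hC.subset hx, fun hxE => ?_⟩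
      exact (hleast _ hC.compl (Set.sdiff_subset_sdiff_right hCA)
        (Set.sdiff_subset_sdiff_right hCB) hxE).2 hx

/-! ### Weak separability from a linear functional -/

theorem exists_nonneg_of_mem_nonnegSpan {X : Set V} (L : V →ₗ[ℝ] ℝ) {u : V} (hu : u ∈ nonnegSpan X)
    (hu0 : u ≠ 0) (hL : 0 ≤ L u) : ∃ a ∈ X, 0 ≤ L a := by
  by_contra hcon
  push Not at hcon
  have : ∀ v ∈ nonnegSpan X, v = 0 ∨ L v < 0 := by
    refine nonnegSpan_induction (fun x hx => Or.inr (hcon x hx)) (Or.inl rfl) ?_ ?_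
    · rintro x y (rfl | hx) (rfl | hy)
      · simp
      · simp [hy]
      · simp [hx]
      · right; rw [map_add]; linarith
    · rintro r hr x (rfl | hx)
      · simp
      · rcases hr.eq_or_lt with rfl | hr
        · simp
        · right; rw [map_smul, smul_eq_mul]; exact mul_neg_of_pos_of_neg hr hx
  rcases this u hu with h | h
  · exact hu0 h
  · linarith

/-- The kernel of a functional of constant sign cuts out a face of the cone. -/
theorem mem_nonnegSpan_inter_ker {X : Set V} (L : V →ₗ[ℝ] ℝ) (hX : ∀ x ∈ X, L x ≤ 0) {u : V}
    (hu : u ∈ nonnegSpan X) (hL : L u = 0) : u ∈ nonnegSpan {x ∈ X | L x = 0} := by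
  have : ∀ v ∈ nonnegSpan X, L v < 0 ∨ (L v = 0 ∧ v ∈ nonnegSpan {x ∈ X | L x = 0}) := by
    refine nonnegSpan_induction (fun x hx => ?_) (Or.inr ⟨map_zero L, zero_mem_nonnegSpan _⟩) ?_ ?_
    · rcases (hX x hx).lt_or_eq with h | h
      · exact Or.inl h
      · exact Or.inr ⟨h, subset_nonnegSpan _ ⟨hx, h⟩⟩
    · rintro x y (hx | ⟨hx, hx'⟩) (hy | ⟨hy, hy'⟩)
      · left; rw [map_add]; linarith
      · left; rw [map_add]; linarith
      · left; rw [map_add]; linarith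
      · right; exact ⟨by rw [map_add, hx, hy, add_zero], add_mem_nonnegSpan hx' hy'⟩
    · rintro r hr x (hx | ⟨hx, hx'⟩)
      · rcases hr.eq_or_lt with rfl | hr
        · right; simpa using zero_mem_nonnegSpan _
        · left; rw [map_smul, smul_eq_mul]; exact mul_neg_of_pos_of_neg hr hx
      · right; exact ⟨by simp [hx], smul_mem_nonnegSpan hr hx'⟩
  rcases this u hu with h | h
  · exact absurd hL h.ne
  · exact h.2

/-- The determinant of three vectors. -/
def det3 (f u v : V) : ℝ :=
  f 0 * (u 1 * v 2 - u 2 * v 1) + f 1 * (u 2 * v 0 - u 0 * v 2) + f 2 * (u 0 * v 1 - u 1 * v 0)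

/-- The determinant as a linear map in the last variable. -/
def det3Map (f u : V) : V →ₗ[ℝ] ℝ where
  toFun := det3 f u
  map_add' x y := by simp only [det3, Pi.add_apply]; ring
  map_smul' r x := by simp only [det3, Pi.smul_apply, smul_eq_mul, RingHom.id_apply]; ring

/-- The linear functional with the given coefficients. -/
def dotMap (f : V) : V →ₗ[ℝ] ℝ where
  toFun x := f 0 * x 0 + f 1 * x 1 + f 2 * x 2
  map_add' x y := by simp only [Pi.add_apply]; ring
  map_smul' r x := by simp only [Pi.smul_apply, smul_eq_mul, RingHom.id_apply]; ring

theorem dotMap_apply (f x : V) : dotMap f x = f 0 * x 0 + f 1 * x 1 + f 2 * x 2 := rfl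

theorem sq_sum_ne_zero {f : V} (hf : f ≠ 0) : f 0 ^ 2 + f 1 ^ 2 + f 2 ^ 2 ≠ 0 := by
  intro h
  apply hf
  have h0 := sq_nonneg (f 0)
  have h1 := sq_nonneg (f 1)
  have h2 := sq_nonneg (f 2)
  ext i
  fin_cases i <;> simp <;> apply pow_eq_zero_iff (two_ne_zero) |>.1 <;> linarith

/-- `det3 f` restricts to an area form on the kernel plane of `f`; this is the three-term relation
among vectors of that plane. -/
theorem plane_relation {f u a b : V} (hf : f ≠ 0) (hu : dotMap f u = 0) (ha : dotMap f a = 0)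
    (hb : dotMap f b = 0) : det3 f u a • b + det3 f a b • u = det3 f u b • a := by
  rw [dotMap_apply] at hu ha hb
  have h : det3 u a b = 0 := by
    refine (mul_eq_zero.1 (?_ : (f 0 ^ 2 + f 1 ^ 2 + f 2 ^ 2) * det3 u a b = 0)).resolve_left
      (sq_sum_ne_zero hf)
    simp only [det3]
    linear_combination (f 0 * (a 1 * b 2 - a 2 * b 1) + f 1 * (a 2 * b 0 - a 0 * b 2) +
      f 2 * (a 0 * b 1 - a 1 * b 0)) * hu -
      (f 0 * (u 1 * b 2 - u 2 * b 1) + f 1 * (u 2 * b 0 - u 0 * b 2) +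
      f 2 * (u 0 * b 1 - u 1 * b 0)) * ha +
      (f 0 * (u 1 * a 2 - u 2 * a 1) + f 1 * (u 2 * a 0 - u 0 * a 2) +
      f 2 * (u 0 * a 1 - u 1 * a 0)) * hb
  simp only [det3] at h
  ext i
  fin_cases i <;> simp [det3]
  · linear_combination f 0 * h
  · linear_combination f 1 * h
  · linear_combination f 2 * h

/-- Coordinate sums serve as scale factors because they are positive on nonzero vectors of the
orthant. -/
theorem parallel_of_det3_eq_zero {f u a : V} (hf : f ≠ 0) (hu : dotMap f u = 0)
    (ha : dotMap f a = 0) (h : det3 f u a = 0) : (u 0 + u 1 + u 2) • a = (a 0 + a 1 + a 2) • u := by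
  rw [dotMap_apply] at hu ha
  have hs := sq_sum_ne_zero hf
  simp only [det3] at h
  have h0 : u 1 * a 2 - u 2 * a 1 = 0 := by
    refine (mul_eq_zero.1 (?_ : (f 0 ^ 2 + f 1 ^ 2 + f 2 ^ 2) * _ = 0)).resolve_left hs
    linear_combination f 0 * h + (f 1 * a 2 - f 2 * a 1) * hu - (f 1 * u 2 - f 2 * u 1) * ha
  have h1 : u 2 * a 0 - u 0 * a 2 = 0 := by
    refine (mul_eq_zero.1 (?_ : (f 0 ^ 2 + f 1 ^ 2 + f 2 ^ 2) * _ = 0)).resolve_left hs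
    linear_combination f 1 * h + (f 2 * a 0 - f 0 * a 2) * hu - (f 2 * u 0 - f 0 * u 2) * ha
  have h2 : u 0 * a 1 - u 1 * a 0 = 0 := by
    refine (mul_eq_zero.1 (?_ : (f 0 ^ 2 + f 1 ^ 2 + f 2 ^ 2) * _ = 0)).resolve_left hs
    linear_combination f 2 * h + (f 0 * a 1 - f 1 * a 0) * hu - (f 0 * u 1 - f 1 * u 0) * ha
  ext i
  fin_cases i <;> simp
  · linear_combination h1 - h2
  · linear_combination h2 - h0
  · linear_combination h0 - h1

theorem sum_pos_of_ne_zero {x : V} (hx : ∀ i, 0 ≤ x i) (h : x ≠ 0) : 0 < x 0 + x 1 + x 2 := by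
  have h0 := hx 0
  have h1 := hx 1
  have h2 := hx 2
  refine lt_of_le_of_ne (by positivity) fun he => h ?_
  ext i
  fin_cases i <;> simp <;> linarith

theorem det3_swap (f u v : V) : det3 f v u = -det3 f u v := by simp only [det3]; ring

/-- Inside the plane, `a` lies between `u` and `b`, while `b'` lies on the other side of `u`; so `a`
is in the cone of `b` and `b'`. If `b` is on the ray of `u`, so is `a`. -/
theorem IsClosedSet.mem_of_plane {S : Set V} (hS : IsClosedSet S) {f u a b b' : V} (hf : f ≠ 0)
    (hu : dotMap f u = 0) (ha : dotMap f a = 0) (hb : dotMap f b = 0) (hb' : dotMap f b' = 0)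
    (hu0 : ∀ i, 0 ≤ u i) (hune : u ≠ 0) (hap : a ∈ posRoots) (hbS : b ∈ S) (hbS' : b' ∈ S)
    (hua : 0 ≤ det3 f u a) (hub : 0 ≤ det3 f u b) (hub' : det3 f u b' ≤ 0)
    (hab : 0 ≤ det3 f a b) : a ∈ S := by
  have spos : ∀ {x}, x ∈ posRoots → 0 < x 0 + x 1 + x 2 := fun hx =>
    sum_pos_of_ne_zero (nonneg_of_mem_posRoots hx) (ne_zero_of_mem_posRoots hx)
  have hbp := hS.1 hbS
  have hsu := sum_pos_of_ne_zero hu0 hune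
  have e1 := plane_relation hf hu ha hb
  rcases hub.eq_or_lt with h0 | h0
  · rw [← h0, zero_smul] at e1
    have hua0 : det3 f u a = 0 := by
      by_contra hne
      exact ne_zero_of_mem_posRoots hbp (eq_zero_of_smul_add (lt_of_le_of_ne hua (Ne.symm hne))
        (nonneg_of_mem_posRoots hbp) (fun i => mul_nonneg hab (hu0 i)) e1)
    have p1 := parallel_of_det3_eq_zero hf hu ha hua0
    have p2 := parallel_of_det3_eq_zero hf hu hb h0.symm
    refine hS.mem hbS hbS hap (t := (u 0 + u 1 + u 2) * (b 0 + b 1 + b 2))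
      (r := (u 0 + u 1 + u 2) * (a 0 + a 1 + a 2)) (s := 0)
      (mul_pos hsu (spos hbp)) (mul_pos hsu (spos hap)).le le_rfl ?_
    rw [mul_comm, mul_smul, p1, mul_comm (u 0 + u 1 + u 2), mul_smul, p2]
    module
  · have e2 := plane_relation hf hu hb hb'
    have hbb : 0 < det3 f b' b := by
      rw [det3_swap]
      by_contra hneg
      have : det3 f u b • b' + (det3 f b b' • u + (-det3 f u b') • b) = 0 := by
        rw [← add_assoc, e2]; module
      exact ne_zero_of_mem_posRoots (hS.1 hbS') (eq_zero_of_smul_add h0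
        (nonneg_of_mem_posRoots (hS.1 hbS')) (fun i => add_nonneg
          (mul_nonneg (by linarith) (hu0 i))
          (mul_nonneg (by linarith) (nonneg_of_mem_posRoots hbp i))) this)
    refine hS.mem hbS hbS' hap (t := det3 f b' b * det3 f u b)
      (r := det3 f b' b * det3 f u a + det3 f a b * (-det3 f u b'))
      (s := det3 f a b * det3 f u b) (mul_pos hbb h0)
      (add_nonneg (mul_nonneg hbb.le hua) (mul_nonneg hab (by linarith)))
      (mul_nonneg hab h0.le) ?_
    have e3 : det3 f b' b • u = det3 f u b • b' + (-det3 f u b') • b := by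
      rw [det3_swap f b b']
      rw [← sub_eq_zero] at e2 ⊢
      rw [← neg_eq_zero, ← e2]; module
    rw [mul_smul, ← e1, smul_add, smul_comm (det3 f b' b) (det3 f a b) u, e3]
    module

/-- A biclosed set is weakly separable if some nonzero linear functional is nonpositive on it and
nonnegative on its complement. -/
theorem separated_of_functional {R : Set V} (hR : IsBiclosed R) {f : V} (hf : f ≠ 0)
    (hneg : ∀ x ∈ R, dotMap f x ≤ 0) (hpos : ∀ x ∈ posRoots \ R, 0 ≤ dotMap f x) :
    nonnegSpan R ∩ nonnegSpan (posRoots \ R) ⊆ {0} := by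
  rintro u ⟨hu, hu'⟩
  by_contra hu0
  replace hu0 : u ≠ 0 := hu0
  have hLu : dotMap f u = 0 := by
    apply le_antisymm
    · exact nonnegSpan_induction (p := fun x => dotMap f x ≤ 0) hneg (by simp)
        (fun x y hx hy => by rw [map_add]; linarith)
        (fun r hr x hx => by rw [map_smul]; exact mul_nonpos_of_nonneg_of_nonpos hr hx) u hu
    · exact nonnegSpan_induction (p := fun x => 0 ≤ dotMap f x) hpos (by simp)
        (fun x y hx hy => by rw [map_add]; linarith)
        (fun r hr x hx => by rw [map_smul]; exact mul_nonneg hr hx) u hu'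
  have hunn := nonneg_of_mem_nonnegSpan hR.subset hu
  have h1 := mem_nonnegSpan_inter_ker (dotMap f) hneg hu hLu
  have h2 := mem_nonnegSpan_inter_ker (-dotMap f) (fun x hx => by simpa using hpos x hx) hu'
    (by simpa using hLu)
  have self : det3 f u u = 0 := by simp only [det3]; ring
  -- Both planar cones contain `u`, so each has generators weakly on both sides of it. Of `a` and
  -- `b`, on the same side, the one nearer to `u` lies between two generators from the other set.
  obtain ⟨a, ⟨haR, ha⟩, hua⟩ := exists_nonneg_of_mem_nonnegSpan (det3Map f u) h1 hu0 self.ge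
  obtain ⟨a', ⟨haR', ha'⟩, hua'⟩ := exists_nonneg_of_mem_nonnegSpan (-det3Map f u) h1 hu0
    (by simp [det3Map, self])
  obtain ⟨b, ⟨hbR, hb⟩, hub⟩ := exists_nonneg_of_mem_nonnegSpan (det3Map f u) h2 hu0 self.ge
  obtain ⟨b', ⟨hbR', hb'⟩, hub'⟩ := exists_nonneg_of_mem_nonnegSpan (-det3Map f u) h2 hu0
    (by simp [det3Map, self])
  replace hua' : det3 f u a' ≤ 0 := by simpa [det3Map] using hua'
  replace hub' : det3 f u b' ≤ 0 := by simpa [det3Map] using hub'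
  replace hb : dotMap f b = 0 := by simpa using hb
  replace hb' : dotMap f b' = 0 := by simpa using hb'
  rcases le_total 0 (det3 f a b) with hab | hab
  · exact (hR.2.mem_of_plane hf hLu ha hb hb' hunn hu0 (hR.subset haR) hbR hbR' hua hub hub'
      hab).2 haR
  · exact hbR.2 (hR.1.mem_of_plane hf hLu hb ha ha' hunn hu0 hbR.1 haR haR' hub hua hua'
      (by rw [det3_swap]; linarith))

end UniversalCoxeter

namespace UniversalCoxeter

open Filter

/-! ### Positive roots as Farey edges -/

/-- The determinant of two integral vectors in the plane. -/
def det2 (a b : ℤ × ℤ) : ℤ := a.1 * b.2 - a.2 * b.1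

/-- The symmetric product of two vectors of the plane, a vector of `V ≃ Sym² ℝ²`. The roots are
the products of the pairs of determinant `±1`. -/
def prodVec (a b : ℤ × ℤ) : V := intVec ![a.2 * b.2, a.1 * b.1, (a.1 - a.2) * (b.1 - b.2)]

theorem prodVec_zero (a b : ℤ × ℤ) : prodVec a b 0 = a.2 * b.2 := by simp [prodVec, intVec]

theorem prodVec_one (a b : ℤ × ℤ) : prodVec a b 1 = a.1 * b.1 := by simp [prodVec, intVec]

theorem prodVec_two (a b : ℤ × ℤ) : prodVec a b 2 = (a.1 - a.2) * (b.1 - b.2) := by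
  simp [prodVec, intVec]

theorem vec_ext {x y : V} (h0 : x 0 = y 0) (h1 : x 1 = y 1) (h2 : x 2 = y 2) : x = y := by
  ext i; fin_cases i <;> assumption

theorem prodVec_comm (a b : ℤ × ℤ) : prodVec a b = prodVec b a := by
  apply vec_ext <;> simp only [prodVec_zero, prodVec_one, prodVec_two] <;> ring

theorem normForm_prod (a b : ℤ × ℤ) :
    normForm ![a.2 * b.2, a.1 * b.1, (a.1 - a.2) * (b.1 - b.2)] = det2 a b ^ 2 := by
  simp [normForm, det2]; ring

theorem intVec_mem_posRoots {y : Fin 3 → ℤ} (h : normForm y = 1) {i : Fin 3} (hi : 0 < y i) :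
    intVec y ∈ posRoots :=
  mem_posRoots_iff.2 ⟨y, h, fun j => nonneg_of_mul_nonneg_right
    (mul_nonneg_of_normForm_eq_one h i j) hi, rfl⟩

theorem prodVec_mem_posRoots {a b : ℤ × ℤ} (h : det2 a b ^ 2 = 1)
    (hpos : 0 < a.1 * b.1 + a.2 * b.2) : prodVec a b ∈ posRoots := by
  have hn := (normForm_prod a b).trans h
  rcases lt_or_ge 0 (a.2 * b.2) with h0 | h0
  · exact intVec_mem_posRoots hn (i := 0) h0
  · exact intVec_mem_posRoots hn (i := 1) (by simp; omega)

theorem prodVec_mem_posRoots_of_pos {a b : ℤ × ℤ} (h : det2 a b ^ 2 = 1)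
    (ha : 0 < a.2) (hb : 0 < b.2) : prodVec a b ∈ posRoots :=
  intVec_mem_posRoots ((normForm_prod a b).trans h) (i := 0) (mul_pos ha hb)

/-- Each simple reflection is induced by an integral involution of the plane that fixes one factor
of its simple root and negates the other. -/
theorem exists_prodVec_of_mem_roots {x : V} (hx : x ∈ roots) :
    ∃ a b : ℤ × ℤ, det2 a b ^ 2 = 1 ∧ x = prodVec a b := by
  refine roots_induction (p := fun x => ∃ a b : ℤ × ℤ, det2 a b ^ 2 = 1 ∧ x = prodVec a b)
    ?_ ?_ x hx
  · intro i
    fin_cases i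
    · refine ⟨(0, 1), (1, 1), by simp [det2], ?_⟩
      apply vec_ext <;> simp [prodVec_zero, prodVec_one, prodVec_two, simpleRoot_apply]
    · refine ⟨(1, 1), (1, 0), by simp [det2], ?_⟩
      apply vec_ext <;> simp [prodVec_zero, prodVec_one, prodVec_two, simpleRoot_apply]
    · refine ⟨(1, 0), (0, -1), by simp [det2], ?_⟩
      apply vec_ext <;> simp [prodVec_zero, prodVec_one, prodVec_two, simpleRoot_apply]
  · rintro i _ ⟨a, b, h, rfl⟩
    fin_cases i
    · refine ⟨(a.1, 2 * a.1 - a.2), (b.1, 2 * b.1 - b.2), ?_, ?_⟩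
      · rw [← h]; simp only [det2]; ring
      · apply vec_ext <;> simp [refl_simpleRoot_apply, prodVec_zero, prodVec_one, prodVec_two] <;>
          ring
    · refine ⟨(2 * a.2 - a.1, a.2), (2 * b.2 - b.1, b.2), ?_, ?_⟩
      · rw [← h]; simp only [det2]; ring
      · apply vec_ext <;> simp [refl_simpleRoot_apply, prodVec_zero, prodVec_one, prodVec_two] <;>
          ring
    · refine ⟨(-a.1, a.2), (-b.1, b.2), ?_, ?_⟩
      · rw [← h]; simp only [det2]; ring
      · apply vec_ext <;> simp [refl_simpleRoot_apply, prodVec_zero, prodVec_one, prodVec_two]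
        ring

/-- The vertices of the level `n` subdivision of the line: level `0` has the integers, each further
level adds the mediants. A vector `(p, q)` stands for the rational number `p / q`. -/
def fareyVertex : ℕ → ℤ → ℤ × ℤ
  | 0, k => (k, 1)
  | n + 1, j => if j % 2 = 0 then fareyVertex n (j / 2)
      else fareyVertex n (j / 2) + fareyVertex n (j / 2 + 1)

theorem fareyVertex_zero (k : ℤ) : fareyVertex 0 k = (k, 1) := rfl

theorem fareyVertex_even (n : ℕ) (i : ℤ) : fareyVertex (n + 1) (2 * i) = fareyVertex n i := by
  simp [fareyVertex]

theorem fareyVertex_odd (n : ℕ) (i : ℤ) :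
    fareyVertex (n + 1) (2 * i + 1) = fareyVertex n i + fareyVertex n (i + 1) := by
  have h1 : (2 * i + 1) % 2 = 1 := by omega
  have h2 : (2 * i + 1) / 2 = i := by omega
  simp [fareyVertex, h1, h2]

theorem fareyVertex_snd_pos (n : ℕ) (i : ℤ) : 0 < (fareyVertex n i).2 := by
  induction n generalizing i with
  | zero => simp [fareyVertex]
  | succ n ih =>
    rcases Int.even_or_odd' i with ⟨j, rfl | rfl⟩
    · rw [fareyVertex_even]; exact ih j
    · rw [fareyVertex_odd]; exact add_pos (ih _) (ih _)

theorem det2_add_left (a b c : ℤ × ℤ) : det2 (a + b) c = det2 a c + det2 b c := by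
  simp only [det2, Prod.fst_add, Prod.snd_add]; ring

theorem det2_add_right (a b c : ℤ × ℤ) : det2 a (b + c) = det2 a b + det2 a c := by
  simp only [det2, Prod.fst_add, Prod.snd_add]; ring

theorem det2_self (a : ℤ × ℤ) : det2 a a = 0 := by simp only [det2]; ring

theorem det2_swap (a b : ℤ × ℤ) : det2 b a = -det2 a b := by simp only [det2]; ring

theorem det2_fareyVertex (n : ℕ) (i : ℤ) :
    det2 (fareyVertex n i) (fareyVertex n (i + 1)) = -1 := by
  induction n generalizing i with
  | zero => simp [fareyVertex, det2]
  | succ n ih =>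
    rcases Int.even_or_odd' i with ⟨j, rfl | rfl⟩
    · rw [fareyVertex_even, fareyVertex_odd, det2_add_right, det2_self, ih, zero_add]
    · rw [show 2 * j + 1 + 1 = 2 * (j + 1) by ring, fareyVertex_even, fareyVertex_odd,
        det2_add_left, det2_self, ih, add_zero]

/-- The positive root of an edge between neighbours at level `n`. -/
def fareyEdge (n : ℕ) (i : ℤ) : V := prodVec (fareyVertex n i) (fareyVertex n (i + 1))

theorem fareyEdge_mem_posRoots (n : ℕ) (i : ℤ) : fareyEdge n i ∈ posRoots :=
  prodVec_mem_posRoots_of_pos (by rw [det2_fareyVertex]; norm_num) (fareyVertex_snd_pos n i)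
    (fareyVertex_snd_pos n _)

theorem fareyEdge_even (n : ℕ) (i : ℤ) : fareyEdge (n + 1) (2 * i) =
    prodVec (fareyVertex n i) (fareyVertex n i + fareyVertex n (i + 1)) := by
  rw [fareyEdge, fareyVertex_even, fareyVertex_odd]

theorem fareyEdge_odd (n : ℕ) (i : ℤ) : fareyEdge (n + 1) (2 * i + 1) =
    prodVec (fareyVertex n i + fareyVertex n (i + 1)) (fareyVertex n (i + 1)) := by
  rw [fareyEdge, show 2 * i + 1 + 1 = 2 * (i + 1) by ring, fareyVertex_even, fareyVertex_odd]

/-- Both neighbours have the same determinant with the middle vertex up to order, so their sum is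
parallel to that vertex, which is primitive; denominators give the sign. -/
theorem exists_add_eq_smul (n : ℕ) (i : ℤ) : ∃ j : ℤ, 0 < j ∧
    fareyVertex n (i - 1) + fareyVertex n (i + 1) = j • fareyVertex n i := by
  have h1 := det2_fareyVertex n (i - 1)
  have h2 := det2_fareyVertex n i
  rw [sub_add_cancel] at h1
  have p0 := fareyVertex_snd_pos n (i - 1)
  have p1 := fareyVertex_snd_pos n i
  have p2 := fareyVertex_snd_pos n (i + 1)
  set u := fareyVertex n (i - 1)
  set v := fareyVertex n i
  set w := fareyVertex n (i + 1)
  have e1 : u.1 + w.1 = -det2 u w * v.1 := by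
    simp only [det2] at h1 h2 ⊢; linear_combination u.1 * h2 + w.1 * h1
  have e2 : u.2 + w.2 = -det2 u w * v.2 := by
    simp only [det2] at h1 h2 ⊢; linear_combination u.2 * h2 + w.2 * h1
  refine ⟨-det2 u w, ?_, Prod.ext e1 e2⟩
  have : 0 < -det2 u w * v.2 := by rw [← e2]; omega
  exact (mul_pos_iff_of_pos_right p1).1 this

/-! ### Closure rules for the edges at a Farey vertex. -/

section Rules

variable {S : Set V}

/-- Edges at a vertex `v` with neighbours `u` and `w` share the factor `v`, hence lie in a plane,
where the other factors come in the angular order `u`, `u + v`, `v + w`, `w`. This rule and the next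
two read off that order; the coefficients come from `u + w = j • v`. -/
theorem IsClosedSet.fareyEdge_split (hS : IsClosedSet S) {n : ℕ} {i : ℤ}
    (h1 : fareyEdge n (i - 1) ∈ S) (h2 : fareyEdge n i ∈ S) :
    fareyEdge (n + 1) (2 * i - 1) ∈ S ∧ fareyEdge (n + 1) (2 * i) ∈ S := by
  obtain ⟨j, hj, e⟩ := exists_add_eq_smul n i
  have hj' : (0 : ℝ) < j := by exact_mod_cast hj
  have e1 : fareyEdge (n + 1) (2 * i - 1) =
      prodVec (fareyVertex n (i - 1) + fareyVertex n i) (fareyVertex n i) := by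
    rw [show 2 * i - 1 = 2 * (i - 1) + 1 by ring, fareyEdge_odd, sub_add_cancel]
  have q1 : fareyEdge n (i - 1) = prodVec (fareyVertex n (i - 1)) (fareyVertex n i) := by
    rw [fareyEdge, sub_add_cancel]
  have m1 := fareyEdge_mem_posRoots (n + 1) (2 * i - 1)
  have m2 := fareyEdge_mem_posRoots (n + 1) (2 * i)
  rw [fareyEdge_even] at *
  rw [e1] at *
  rw [q1] at h1
  rw [fareyEdge] at h2
  have hw : fareyVertex n (i + 1) = j • fareyVertex n i - fareyVertex n (i - 1) := by
    rw [← e]; abel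
  rw [hw] at h2 m2 ⊢
  constructor
  · refine hS.mem h1 h2 m1 (t := j) (r := j + 1) (s := 1) hj' (by linarith) zero_le_one ?_
    apply vec_ext <;> simp [prodVec_zero, prodVec_one, prodVec_two] <;> ring
  · refine hS.mem h1 h2 m2 (t := j) (r := 1) (s := j + 1) hj' zero_le_one (by linarith) ?_
    apply vec_ext <;> simp [prodVec_zero, prodVec_one, prodVec_two] <;> ring

theorem IsClosedSet.fareyEdge_left (hS : IsClosedSet S) {n : ℕ} {i : ℤ}
    (h1 : fareyEdge n (i - 1) ∈ S) (h2 : fareyEdge (n + 1) (2 * i) ∈ S) :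
    fareyEdge (n + 1) (2 * i - 1) ∈ S := by
  obtain ⟨j, hj, e⟩ := exists_add_eq_smul n i
  have hj' : (0 : ℝ) < j := by exact_mod_cast hj
  have e1 : fareyEdge (n + 1) (2 * i - 1) =
      prodVec (fareyVertex n (i - 1) + fareyVertex n i) (fareyVertex n i) := by
    rw [show 2 * i - 1 = 2 * (i - 1) + 1 by ring, fareyEdge_odd, sub_add_cancel]
  have q1 : fareyEdge n (i - 1) = prodVec (fareyVertex n (i - 1)) (fareyVertex n i) := by
    rw [fareyEdge, sub_add_cancel]
  have m1 := fareyEdge_mem_posRoots (n + 1) (2 * i - 1)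
  rw [e1] at *
  rw [q1] at h1
  rw [fareyEdge_even] at h2
  have hw : fareyVertex n (i + 1) = j • fareyVertex n i - fareyVertex n (i - 1) := by
    rw [← e]; abel
  rw [hw] at h2
  refine hS.mem h1 h2 m1 (t := j + 1) (r := j + 2) (s := 1) (by linarith) (by linarith)
    zero_le_one ?_
  apply vec_ext <;> simp [prodVec_zero, prodVec_one, prodVec_two] <;> ring

theorem IsClosedSet.fareyEdge_right (hS : IsClosedSet S) {n : ℕ} {i : ℤ}
    (h1 : fareyEdge n i ∈ S) (h2 : fareyEdge (n + 1) (2 * i - 1) ∈ S) :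
    fareyEdge (n + 1) (2 * i) ∈ S := by
  obtain ⟨j, hj, e⟩ := exists_add_eq_smul n i
  have hj' : (0 : ℝ) < j := by exact_mod_cast hj
  have e1 : fareyEdge (n + 1) (2 * i - 1) =
      prodVec (fareyVertex n (i - 1) + fareyVertex n i) (fareyVertex n i) := by
    rw [show 2 * i - 1 = 2 * (i - 1) + 1 by ring, fareyEdge_odd, sub_add_cancel]
  have m2 := fareyEdge_mem_posRoots (n + 1) (2 * i)
  rw [e1] at h2
  rw [fareyEdge] at h1
  rw [fareyEdge_even] at *
  have hw : fareyVertex n (i + 1) = j • fareyVertex n i - fareyVertex n (i - 1) := by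
    rw [← e]; abel
  rw [hw] at h1 m2 ⊢
  refine hS.mem h1 h2 m2 (t := j + 1) (r := j + 2) (s := 1) (by linarith) (by linarith)
    zero_le_one ?_
  apply vec_ext <;> simp [prodVec_zero, prodVec_one, prodVec_two] <;> ring

end Rules

/-- Biclosed sets that contain exactly the first simple root. -/
structure IsNormalized (R : Set V) : Prop where
  biclosed : IsBiclosed R
  first : simpleRoot 0 ∈ R
  second : simpleRoot 1 ∉ R
  third : simpleRoot 2 ∉ R

/-- The indices of the level `n` edges in `R`. -/
def levelSet (R : Set V) (n : ℕ) : Set ℤ := {i | fareyEdge n i ∈ R}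

theorem fareyEdge_mem_compl {R : Set V} {n : ℕ} {i : ℤ} :
    fareyEdge n i ∈ posRoots \ R ↔ i ∉ levelSet R n :=
  ⟨fun h => h.2, fun h => ⟨fareyEdge_mem_posRoots n i, h⟩⟩

/-! ### Convexity of the level sets. -/

namespace IsNormalized

variable {R : Set V} (hR : IsNormalized R)
include hR

/-- These roots are the edges at ∞. They are nonnegative combinations of the two simple roots
outside `R`. -/
theorem notMem_of_coord_eq_zero {x : V} (hx : x ∈ posRoots) (h0 : x 0 = 0) : x ∉ R := by
  have h1 := nonneg_of_mem_posRoots hx 1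
  have h2 := nonneg_of_mem_posRoots hx 2
  refine (hR.biclosed.2.mem (a := simpleRoot 1) (b := simpleRoot 2)
    ⟨simpleRoot_mem_posRoots 1, hR.second⟩ ⟨simpleRoot_mem_posRoots 2, hR.third⟩ hx
    one_pos h1 h2 ?_).2
  apply vec_ext <;> simp [simpleRoot_apply, h0]

theorem split_mem {n : ℕ} {i : ℤ} (h1 : i - 1 ∈ levelSet R n) (h2 : i ∈ levelSet R n) :
    2 * i - 1 ∈ levelSet R (n + 1) ∧ 2 * i ∈ levelSet R (n + 1) :=
  hR.biclosed.1.fareyEdge_split h1 h2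

theorem split_notMem {n : ℕ} {i : ℤ} (h1 : i - 1 ∉ levelSet R n) (h2 : i ∉ levelSet R n) :
    2 * i - 1 ∉ levelSet R (n + 1) ∧ 2 * i ∉ levelSet R (n + 1) := by
  have := hR.biclosed.2.fareyEdge_split (fareyEdge_mem_compl.2 h1) (fareyEdge_mem_compl.2 h2)
  exact ⟨fareyEdge_mem_compl.1 this.1, fareyEdge_mem_compl.1 this.2⟩

theorem left_notMem {n : ℕ} {i : ℤ} (h1 : i - 1 ∉ levelSet R n)
    (h2 : 2 * i - 1 ∈ levelSet R (n + 1)) : 2 * i ∈ levelSet R (n + 1) := by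
  by_contra h
  exact (hR.biclosed.2.fareyEdge_left (fareyEdge_mem_compl.2 h1) (fareyEdge_mem_compl.2 h)).2 h2

theorem right_notMem {n : ℕ} {i : ℤ} (h1 : i ∉ levelSet R n)
    (h2 : 2 * i ∈ levelSet R (n + 1)) : 2 * i - 1 ∈ levelSet R (n + 1) := by
  by_contra h
  exact (hR.biclosed.2.fareyEdge_right (fareyEdge_mem_compl.2 h1) (fareyEdge_mem_compl.2 h)).2 h2

theorem zero_mem : (0 : ℤ) ∈ levelSet R 0 := by
  have : fareyEdge 0 0 = simpleRoot 0 := by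
    apply vec_ext <;>
      simp [fareyEdge, fareyVertex, prodVec_zero, prodVec_one, prodVec_two, simpleRoot_apply]
  rw [levelSet, Set.mem_ofPred_eq, this]
  exact hR.first

theorem pred_mem {k : ℤ} (hk : 1 ≤ k) (h : k ∈ levelSet R 0) : k - 1 ∈ levelSet R 0 := by
  by_contra hcon
  -- The edges `k - 1` and `k` differ by twice the edge from `k` to ∞, which is outside `R`.
  have hm : prodVec (k, 1) (1, 0) ∈ posRoots :=
    prodVec_mem_posRoots (by simp [det2]) (by simp; omega)
  have hm' := hR.notMem_of_coord_eq_zero hm (by simp [prodVec_zero])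
  refine (hR.biclosed.2.mem (fareyEdge_mem_compl.2 hcon) ⟨hm, hm'⟩ (fareyEdge_mem_posRoots 0 k)
    one_pos zero_le_one zero_le_two ?_).2 h
  apply vec_ext <;>
    simp [fareyEdge, fareyVertex, prodVec_zero, prodVec_one, prodVec_two] <;> ring

theorem succ_mem {k : ℤ} (hk : k ≤ 0) (h : k - 1 ∈ levelSet R 0) : k ∈ levelSet R 0 := by
  by_contra hcon
  have hm : prodVec (k, 1) (-1, 0) ∈ posRoots := by
    refine intVec_mem_posRoots ((normForm_prod _ _).trans (by simp [det2])) (i := 2) ?_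
    simp; omega
  have hm' := hR.notMem_of_coord_eq_zero hm (by simp [prodVec_zero])
  refine (hR.biclosed.2.mem (fareyEdge_mem_compl.2 hcon) ⟨hm, hm'⟩ (fareyEdge_mem_posRoots 0 (k - 1))
    one_pos zero_le_one zero_le_two ?_).2 h
  apply vec_ext <;>
    simp [fareyEdge, fareyVertex, prodVec_zero, prodVec_one, prodVec_two] <;> ring

theorem levelSet_zero_convex {i j k : ℤ} (hij : i ≤ j) (hjk : j ≤ k) (hi : i ∈ levelSet R 0)
    (hk : k ∈ levelSet R 0) : j ∈ levelSet R 0 := by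
  rcases le_total 0 j with hj | hj
  · refine Int.leInductionDown (m := k) (motive := fun l _ => 0 ≤ l → l ∈ levelSet R 0)
      (fun _ => hk) ?_ j hjk hj
    intro n _ ih hn
    exact hR.pred_mem (by omega) (ih (by omega))
  · refine Int.leInduction (m := i) (motive := fun l _ => l ≤ 0 → l ∈ levelSet R 0)
      (fun _ => hi) ?_ j hij hj
    intro n _ ih hn
    exact hR.succ_mem hn (by simpa using ih (by omega))

/-- The edges of `R` at a fixed level form an interval. -/
theorem levelSet_convex (n : ℕ) {i j k : ℤ} (hij : i ≤ j) (hjk : j ≤ k)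
    (hi : i ∈ levelSet R n) (hk : k ∈ levelSet R n) : j ∈ levelSet R n := by
  induction n generalizing i j k with
  | zero => exact hR.levelSet_zero_convex hij hjk hi hk
  | succ n ih =>
    -- Each edge of level `n + 1` has exactly one end from level `n`; the edges with old end `l` are
    -- `2 * l - 1` and `2 * l`.
    have touch : ∀ {l}, 2 * l - 1 ∈ levelSet R (n + 1) ∨ 2 * l ∈ levelSet R (n + 1) →
        l - 1 ∈ levelSet R n ∨ l ∈ levelSet R n := by
      intro l h
      by_contra hcon
      push Not at hcon
      have := hR.split_notMem hcon.1 hcon.2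
      tauto
    have form : ∀ l : ℤ, ∃ v, l = 2 * v - 1 ∨ l = 2 * v := by
      intro l
      rcases Int.even_or_odd' l with ⟨v, rfl | rfl⟩
      · exact ⟨v, Or.inr rfl⟩
      · exact ⟨v + 1, Or.inl (by ring)⟩
    -- Let `a ≤ b ≤ c` be the old ends of the three edges. The gap at `j` forces an old edge at `b`
    -- to be missing, while `R` has old edges at `a` and at `c`. If `a < b < c`, this contradicts
    -- the induction hypothesis; if two ends agree, `left_notMem` or `right_notMem` tells which old
    -- edge at `b` is present.
    by_contra hj
    obtain ⟨a, ha⟩ := form i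
    obtain ⟨b, hb⟩ := form j
    obtain ⟨c, hc⟩ := form k
    have ta : a - 1 ∈ levelSet R n ∨ a ∈ levelSet R n :=
      touch (by rcases ha with rfl | rfl <;> tauto)
    have tc : c - 1 ∈ levelSet R n ∨ c ∈ levelSet R n :=
      touch (by rcases hc with rfl | rfl <;> tauto)
    have hnb : ¬ (b - 1 ∈ levelSet R n ∧ b ∈ levelSet R n) := by
      rintro ⟨h1, h2⟩
      have := hR.split_mem h1 h2
      rcases hb with rfl | rfl <;> tauto
    have hmid : ∀ {x y z : ℤ}, x ∈ levelSet R n → z ∈ levelSet R n → x ≤ y → y ≤ z →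
        y ∈ levelSet R n := fun hx hz hxy hyz => ih hxy hyz hx hz
    by_cases hab : a = b
    · subst hab
      have hi' : i = 2 * a - 1 := by
        rcases ha with h | h
        · exact h
        · rcases hb with h' | h'
          · omega
          · exact absurd (by rwa [h', ← h]) hj
      have hj' : j = 2 * a := by
        rcases hb with h | h
        · exact absurd (by rwa [h, ← hi']) hj
        · exact h
      subst hi' hj'
      have h1 : a - 1 ∈ levelSet R n := by
        by_contra h; exact hj (hR.left_notMem h hi)
      have h2 : a ∉ levelSet R n := fun h => hnb ⟨h1, h⟩
      have hac : a < c := by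
        rcases hc with rfl | rfl
        · omega
        · have : c ≠ a := by rintro rfl; exact hj hk
          omega
      rcases tc with h | h
      · exact h2 (hmid h1 h (by omega) (by omega))
      · exact h2 (hmid h1 h (by omega) (by omega))
    by_cases hbc : b = c
    · subst hbc
      have hk' : k = 2 * b := by
        rcases hc with h | h
        · rcases hb with h' | h'
          · exact absurd (by rwa [h', ← h]) hj
          · omega
        · exact h
      have hj' : j = 2 * b - 1 := by
        rcases hb with h | h
        · exact h
        · exact absurd (by rwa [h, ← hk']) hj
      subst hk' hj'
      have h1 : b ∈ levelSet R n := by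
        by_contra h; exact hj (hR.right_notMem h hk)
      have h2 : b - 1 ∉ levelSet R n := fun h => hnb ⟨h, h1⟩
      rcases ta with h | h
      · exact h2 (hmid h h1 (by omega) (by omega))
      · exact h2 (hmid h h1 (by omega) (by omega))
    · have hab' : a < b := by omega
      have hbc' : b < c := by omega
      refine hnb ⟨?_, ?_⟩ <;> rcases ta with h | h <;> rcases tc with h' | h' <;>
        exact hmid h h' (by omega) (by omega)

end IsNormalized

end UniversalCoxeter

namespace UniversalCoxeter

open Filter

/-! ### Vertices whose edges eventually lie in a set -/

/-- All but finitely many of the positive roots at the vertex `v` lie in `R`. -/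
def IsDeep (R : Set V) (v : ℤ × ℤ) : Prop :=
  ∀ w : ℤ × ℤ, det2 v w ^ 2 = 1 → ∀ᶠ k : ℤ in atTop, prodVec v (w + k • v) ∈ R

/-- Vertices persist under subdivision; this brings vertices of different levels to a common one. -/
theorem fareyVertex_pow (n k : ℕ) (i : ℤ) :
    fareyVertex (n + k) (2 ^ k * i) = fareyVertex n i := by
  induction k with
  | zero => simp
  | succ k ih => rw [pow_succ', mul_assoc, ← add_assoc, fareyVertex_even, ih]

/-- Each subdivision replaces the neighbour of a fixed vertex by its mediant with that vertex. -/
theorem fareyVertex_pow_add_one (n k : ℕ) (i : ℤ) :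
    fareyVertex (n + k) (2 ^ k * i + 1) = fareyVertex n (i + 1) + (k : ℤ) • fareyVertex n i := by
  induction k with
  | zero => simp
  | succ k ih =>
    rw [pow_succ', mul_assoc, ← add_assoc, fareyVertex_odd, ih, fareyVertex_pow]
    push_cast; module

theorem fareyVertex_pow_sub_one (n k : ℕ) (i : ℤ) :
    fareyVertex (n + k) (2 ^ k * i - 1) = fareyVertex n (i - 1) + (k : ℤ) • fareyVertex n i := by
  induction k with
  | zero => simp
  | succ k ih =>
    rw [pow_succ', mul_assoc, ← add_assoc,
      show 2 * (2 ^ k * i) - 1 = 2 * (2 ^ k * i - 1) + 1 by ring, fareyVertex_odd, ih,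
      sub_add_cancel, fareyVertex_pow]
    push_cast; module

theorem fareyEdge_pow (n k : ℕ) (i : ℤ) : fareyEdge (n + k) (2 ^ k * i) =
    prodVec (fareyVertex n i) (fareyVertex n (i + 1) + (k : ℤ) • fareyVertex n i) := by
  rw [fareyEdge, fareyVertex_pow, fareyVertex_pow_add_one]

theorem fareyEdge_pow_sub_one (n k : ℕ) (i : ℤ) : fareyEdge (n + k) (2 ^ k * i - 1) =
    prodVec (fareyVertex n i) (fareyVertex n (i - 1) + (k : ℤ) • fareyVertex n i) := by
  rw [fareyEdge, sub_add_cancel, fareyVertex_pow, fareyVertex_pow_sub_one, prodVec_comm]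

/-- Euclidean algorithm: the end with the larger denominator is the mediant of the other end and
their difference. Equal denominators must be `1`, which is level `0`. -/
theorem exists_eq_fareyEdge {a b : ℤ × ℤ} (h : det2 a b = -1) (ha : 0 < a.2) (hb : 0 < b.2) :
    ∃ n i, a = fareyVertex n i ∧ b = fareyVertex n (i + 1) := by
  induction hm : (a.2 + b.2).toNat using Nat.strong_induction_on generalizing a b with
  | _ m ih =>
  rcases lt_trichotomy a.2 b.2 with hab | hab | hab
  · obtain ⟨n, i, h1, h2⟩ := ih _ (by simp only [Prod.snd_sub]; omega) (a := a) (b := b - a)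
      (by simp only [det2, Prod.fst_sub, Prod.snd_sub] at h ⊢; linarith) ha
      (by simp only [Prod.snd_sub]; omega) rfl
    refine ⟨n + 1, 2 * i, by rw [fareyVertex_even, h1], ?_⟩
    rw [fareyVertex_odd, ← h1, ← h2]; abel
  · have h1 : (b.1 - a.1) * a.2 = 1 := by
      simp only [det2] at h; rw [← hab] at h; linear_combination -h
    have h2 : a.2 = 1 := by
      rcases Int.eq_one_or_neg_one_of_mul_eq_one' h1 with h | h <;> omega
    rw [h2, mul_one] at h1
    refine ⟨0, a.1, Prod.ext rfl h2, Prod.ext ?_ (by rw [← hab, h2]; rfl)⟩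
    simp only [fareyVertex_zero]; omega
  · obtain ⟨n, i, h1, h2⟩ := ih _ (by simp only [Prod.snd_sub]; omega) (a := a - b) (b := b)
      (by simp only [det2, Prod.fst_sub, Prod.snd_sub] at h ⊢; linarith)
      (by simp only [Prod.snd_sub]; omega) hb rfl
    refine ⟨n + 1, 2 * i + 1, ?_, ?_⟩
    · rw [fareyVertex_odd, ← h1, ← h2]; abel
    · rw [show 2 * i + 1 + 1 = 2 * (i + 1) by ring, fareyVertex_even, h2]

theorem exists_eq_fareyVertex {v w : ℤ × ℤ} (h : det2 v w ^ 2 = 1) (hv : 0 < v.2) :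
    ∃ n i, v = fareyVertex n i := by
  obtain ⟨w', hw'⟩ : ∃ w', det2 v w' = -1 := by
    rcases sq_eq_one_iff.1 h with h | h
    · exact ⟨-w, by simp only [det2, Prod.fst_neg, Prod.snd_neg] at h ⊢; linarith⟩
    · exact ⟨w, h⟩
  -- Adding a large multiple of `v` to its partner keeps the determinant and makes the denominator
  -- positive.
  obtain ⟨n, i, h1, -⟩ := exists_eq_fareyEdge (a := v) (b := w' + (|w'.2| + 1) • v)
    (by simp only [det2, Prod.fst_add, Prod.snd_add, Prod.smul_fst, Prod.smul_snd, smul_eq_mul]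
          at hw' ⊢; linarith) hv
    (by
      simp only [Prod.snd_add, Prod.smul_snd, smul_eq_mul]
      have := neg_abs_le w'.2
      nlinarith [abs_nonneg w'.2])
  exact ⟨n, i, h1⟩

/-- The rational number represented by an integral vector. -/
noncomputable def slope (v : ℤ × ℤ) : ℝ := v.1 / v.2

theorem slope_fareyVertex_strictMono (n : ℕ) : StrictMono fun i => slope (fareyVertex n i) := by
  refine strictMono_int_of_lt_succ fun i => ?_
  have h1 : (0 : ℝ) < (fareyVertex n i).2 := by exact_mod_cast fareyVertex_snd_pos n i
  have h2 : (0 : ℝ) < (fareyVertex n (i + 1)).2 := by exact_mod_cast fareyVertex_snd_pos n (i + 1)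
  have h := det2_fareyVertex n i
  simp only [slope]
  rw [div_lt_div_iff₀ h1 h2]
  simp only [det2] at h
  have h' : ((fareyVertex n i).1 : ℝ) * (fareyVertex n (i + 1)).2 -
    (fareyVertex n i).2 * (fareyVertex n (i + 1)).1 = -1 := by exact_mod_cast h
  linarith

theorem eq_of_slope_fareyVertex_eq {n m : ℕ} {i j : ℤ}
    (h : slope (fareyVertex n i) = slope (fareyVertex m j)) : fareyVertex n i = fareyVertex m j := by
  have h1 := fareyVertex_pow n m i
  have h2 := fareyVertex_pow m n j
  rw [add_comm] at h2
  rw [← h1, ← h2] at h ⊢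
  rw [(slope_fareyVertex_strictMono _).injective h]

theorem IsDeep.exists_mem_levelSet {R : Set V} {n : ℕ} {i : ℤ}
    (h : IsDeep R (fareyVertex n i)) :
    ∃ k₀ : ℕ, ∀ k ≥ k₀, 2 ^ k * i - 1 ∈ levelSet R (n + k) ∧ 2 ^ k * i ∈ levelSet R (n + k) := by
  have d1 := det2_fareyVertex n (i - 1)
  have d2 := det2_fareyVertex n i
  rw [sub_add_cancel, det2_swap] at d1
  have h1 := h (fareyVertex n (i - 1)) (by rw [neg_inj.1 d1]; norm_num)
  have h2 := h (fareyVertex n (i + 1)) (by rw [d2]; norm_num)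
  obtain ⟨K, hK⟩ := (h1.and h2).exists_forall_of_atTop
  refine ⟨K.toNat, fun k hk => ?_⟩
  have := hK k (by omega)
  rwa [← fareyEdge_pow, ← fareyEdge_pow_sub_one] at this

/-! ### Deep vertices of a normalized set form an interval. -/

namespace IsNormalized

variable {R : Set V} (hR : IsNormalized R)
include hR

theorem split_mem_add {n : ℕ} {i : ℤ} (h1 : i - 1 ∈ levelSet R n) (h2 : i ∈ levelSet R n) (k : ℕ) :
    2 ^ k * i - 1 ∈ levelSet R (n + k) ∧ 2 ^ k * i ∈ levelSet R (n + k) := by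
  induction k with
  | zero => simpa using ⟨h1, h2⟩
  | succ k ih =>
    rw [pow_succ', mul_assoc, ← add_assoc]
    exact hR.split_mem ih.1 ih.2

theorem split_notMem_add {n : ℕ} {i : ℤ} (h1 : i - 1 ∉ levelSet R n) (h2 : i ∉ levelSet R n)
    (k : ℕ) : 2 ^ k * i - 1 ∉ levelSet R (n + k) ∧ 2 ^ k * i ∉ levelSet R (n + k) := by
  induction k with
  | zero => simpa using ⟨h1, h2⟩
  | succ k ih =>
    rw [pow_succ', mul_assoc, ← add_assoc]
    exact hR.split_notMem ih.1 ih.2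

/-- Repeated splitting puts the edges from `v` to `u + k • v` and `x + k • v` into `R` for all `k ≥
0`, where `u` and `x` are the neighbours of `v`. Every partner of `v` is `u` or `x` plus a multiple
of `v`, according to the sign of the determinant. -/
theorem isDeep_of_mem {n : ℕ} {i : ℤ} (h1 : i - 1 ∈ levelSet R n) (h2 : i ∈ levelSet R n) :
    IsDeep R (fareyVertex n i) := by
  have d1 := det2_fareyVertex n (i - 1)
  have d2 := det2_fareyVertex n i
  rw [sub_add_cancel] at d1
  have m1 : ∀ k : ℤ, 0 ≤ k →
      prodVec (fareyVertex n i) (fareyVertex n (i - 1) + k • fareyVertex n i) ∈ R := by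
    intro k hk
    lift k to ℕ using hk
    rw [← fareyEdge_pow_sub_one]
    exact (hR.split_mem_add h1 h2 k).1
  have m2 : ∀ k : ℤ, 0 ≤ k →
      prodVec (fareyVertex n i) (fareyVertex n (i + 1) + k • fareyVertex n i) ∈ R := by
    intro k hk
    lift k to ℕ using hk
    rw [← fareyEdge_pow]
    exact (hR.split_mem_add h1 h2 k).2
  intro w hw
  set u := fareyVertex n (i - 1)
  set v := fareyVertex n i
  set x := fareyVertex n (i + 1)
  rcases sq_eq_one_iff.1 hw with h | h
  · have e : w = u + (-det2 u w) • v := by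
      apply Prod.ext <;>
        simp only [det2, Prod.fst_add, Prod.snd_add, Prod.smul_fst, Prod.smul_snd, smul_eq_mul]
          at h d1 ⊢
      · linear_combination u.1 * h + w.1 * d1
      · linear_combination u.2 * h + w.2 * d1
    filter_upwards [eventually_ge_atTop (det2 u w)] with k hk
    rw [e, add_assoc, ← add_smul]
    exact m1 _ (by omega)
  · have e : w = x + (det2 x w) • v := by
      apply Prod.ext <;>
        simp only [det2, Prod.fst_add, Prod.snd_add, Prod.smul_fst, Prod.smul_snd, smul_eq_mul]
          at h d2 ⊢
      · linear_combination w.1 * d2 - x.1 * h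
      · linear_combination w.2 * d2 - x.2 * h
    filter_upwards [eventually_ge_atTop (-det2 x w)] with k hk
    rw [e, add_assoc, ← add_smul]
    exact m2 _ (by omega)

theorem not_isDeep_of_notMem {n : ℕ} {i : ℤ} (h1 : i - 1 ∉ levelSet R n)
    (h2 : i ∉ levelSet R n) : ¬ IsDeep R (fareyVertex n i) := by
  intro h
  obtain ⟨k, hk⟩ := h.exists_mem_levelSet
  exact (hR.split_notMem_add h1 h2 k).1 (hk k le_rfl).1

/-- At a fine enough level `R` has an edge at each outer vertex, on either side of the two edges at
the middle one; level sets are convex. -/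
theorem isDeep_convex_aux {n : ℕ} {i j k : ℤ} (hij : i < j) (hjk : j < k)
    (hi : IsDeep R (fareyVertex n i)) (hk : IsDeep R (fareyVertex n k)) :
    IsDeep R (fareyVertex n j) := by
  obtain ⟨k1, h1⟩ := hi.exists_mem_levelSet
  obtain ⟨k2, h2⟩ := hk.exists_mem_levelSet
  set m := max k1 k2
  have g1 := (h1 m (le_max_left _ _)).2
  have g2 := (h2 m (le_max_right _ _)).1
  have hp : (0 : ℤ) < 2 ^ m := by positivity
  have e1 : (2 : ℤ) ^ m * i + 2 ^ m ≤ 2 ^ m * j := by nlinarith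
  have e2 : (2 : ℤ) ^ m * j + 2 ^ m ≤ 2 ^ m * k := by nlinarith
  rw [← fareyVertex_pow n m j]
  exact hR.isDeep_of_mem (hR.levelSet_convex _ (by omega) (by omega) g1 g2)
    (hR.levelSet_convex _ (by omega) (by omega) g1 g2)

theorem isDeep_convex {n₁ n₂ n₃ : ℕ} {i₁ i₂ i₃ : ℤ}
    (h12 : slope (fareyVertex n₁ i₁) < slope (fareyVertex n₂ i₂))
    (h23 : slope (fareyVertex n₂ i₂) < slope (fareyVertex n₃ i₃))
    (h1 : IsDeep R (fareyVertex n₁ i₁)) (h3 : IsDeep R (fareyVertex n₃ i₃)) :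
    IsDeep R (fareyVertex n₂ i₂) := by
  have e1 := fareyVertex_pow n₁ (n₂ + n₃) i₁
  have e2 := fareyVertex_pow n₂ (n₁ + n₃) i₂
  have e3 := fareyVertex_pow n₃ (n₁ + n₂) i₃
  rw [show n₂ + (n₁ + n₃) = n₁ + (n₂ + n₃) by ring] at e2
  rw [show n₃ + (n₁ + n₂) = n₁ + (n₂ + n₃) by ring] at e3
  rw [← e1] at h12 h1
  rw [← e2] at h12 h23 ⊢
  rw [← e3] at h23 h3
  exact hR.isDeep_convex_aux ((slope_fareyVertex_strictMono _).lt_iff_lt.1 h12)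
    ((slope_fareyVertex_strictMono _).lt_iff_lt.1 h23) h1 h3

theorem not_isDeep_of_snd_eq_zero {v w : ℤ × ℤ} (h : det2 v w ^ 2 = 1) (hv : v.2 = 0) :
    ¬ IsDeep R v := by
  intro hd
  have hv1 : v.1 ≠ 0 := by
    intro h0; simp [det2, hv, h0] at h
  have h1 : (1 : ℤ) ≤ v.1 * v.1 := by have := mul_self_pos.2 hv1; omega
  obtain ⟨k, hk, hk'⟩ := ((hd w h).and (eventually_ge_atTop (|v.1 * w.1| + 1))).exists
  have hp : prodVec v (w + k • v) ∈ posRoots := hR.biclosed.subset hk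
  exact hR.notMem_of_coord_eq_zero hp (by rw [prodVec_zero, hv]; simp) hk

end IsNormalized

theorem IsDeep.neg {R : Set V} {v : ℤ × ℤ} (h : IsDeep R v) : IsDeep R (-v) := by
  intro w hw
  have := h (-w) (by rw [← hw]; simp only [det2, Prod.fst_neg, Prod.snd_neg]; ring)
  filter_upwards [this] with k hk
  convert hk using 1
  apply vec_ext <;> simp [prodVec_zero, prodVec_one, prodVec_two] <;> ring

/-! ### The sign of an indefinite form on the roots -/

/-- The linear functional on `V ≃ Sym² ℝ²` given by the polarization of a quadratic form. -/
def polarCoeff (c₁ c₂ c₃ : ℝ) : V := ![c₂ + c₃, c₁ + c₂, -c₂]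

theorem dotMap_polarCoeff (c₁ c₂ c₃ : ℝ) (a b : ℤ × ℤ) :
    dotMap (polarCoeff c₁ c₂ c₃) (prodVec a b) =
      c₁ * (a.1 * b.1) + c₂ * (a.1 * b.2 + a.2 * b.1) + c₃ * (a.2 * b.2) := by
  rw [dotMap_apply, prodVec_zero, prodVec_one, prodVec_two]
  simp [polarCoeff]; ring

/-- For `t = √(|α| / |β|)` the terms `α` and `β * t ^ 2` have equal size: with opposite signs they
cancel, otherwise `α * β < B ^ 2` gives `|α| < |B| * t`. A small `t` serves when `α = 0`, a large
one when `β = 0`. -/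
theorem exists_real_balanced {α β B : ℝ} (hB : B ≠ 0) (h : α * β < B ^ 2) :
    ∃ t : ℝ, 0 < t ∧ |α + β * t ^ 2| < 2 * |B| * t := by
  have hB' : 0 < |B| := abs_pos.2 hB
  by_cases hα : α = 0
  · refine ⟨|B| / (|β| + 1), by positivity, ?_⟩
    have hb : 0 < |β| + 1 := by positivity
    set t := |B| / (|β| + 1) with ht
    have ht0 : 0 < t := by positivity
    have : t * (|β| + 1) = |B| := by rw [ht]; field_simp
    rw [hα, zero_add, abs_mul, abs_of_pos (by positivity : 0 < t ^ 2), ← this]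
    nlinarith [abs_nonneg β, mul_pos ht0 ht0, mul_nonneg (abs_nonneg β) (mul_pos ht0 ht0).le]
  by_cases hβ : β = 0
  · refine ⟨(|α| + 1) / |B|, by positivity, ?_⟩
    rw [hβ, zero_mul, add_zero]
    have : 2 * |B| * ((|α| + 1) / |B|) = 2 * (|α| + 1) := by field_simp
    rw [this]
    linarith [abs_nonneg α]
  · have ha : 0 < |α| := abs_pos.2 hα
    have hb : 0 < |β| := abs_pos.2 hβ
    refine ⟨√(|α| / |β|), Real.sqrt_pos.2 (by positivity), ?_⟩
    set t := √(|α| / |β|) with ht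
    have ht0 : 0 < t := Real.sqrt_pos.2 (by positivity)
    have hsq : t ^ 2 = |α| / |β| := Real.sq_sqrt (by positivity)
    have hsq' : |β| * t ^ 2 = |α| := by rw [hsq]; field_simp
    rcases lt_or_ge (α * β) 0 with hneg | hneg
    · have h0 : α + β * t ^ 2 = 0 := by
        rcases mul_neg_iff.1 hneg with ⟨h1, h2⟩ | ⟨h1, h2⟩
        · rw [abs_of_pos h1, abs_of_neg h2] at hsq'; linarith
        · rw [abs_of_neg h1, abs_of_pos h2] at hsq'; linarith
      rw [h0, abs_zero]; positivity
    · have h1 : |α + β * t ^ 2| ≤ 2 * |α| := by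
        refine (abs_add_le _ _).trans ?_
        rw [abs_mul, abs_of_pos (by positivity : 0 < t ^ 2), hsq']; linarith
      refine h1.trans_lt ?_
      have h2 : |α| * |β| < |B| ^ 2 := by rw [← abs_mul, abs_of_nonneg hneg, sq_abs]; exact h
      have h3 : |α| < |B| * t := by
        refine lt_of_pow_lt_pow_left₀ 2 (by positivity) ?_
        rw [mul_pow, hsq]
        rw [mul_div_assoc', lt_div_iff₀ hb]
        nlinarith
      linarith

/-- The real condition is open, so it has a rational solution; clear denominators. The bound says
that `α s² + β t² ± 2 B s t` has the sign of `± B`. -/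
theorem exists_coprime_balanced {α β B : ℝ} (hB : B ≠ 0) (h : α * β < B ^ 2) :
    ∃ s t : ℤ, 0 < s ∧ 0 < t ∧ IsCoprime s t ∧
      |α * s ^ 2 + β * t ^ 2| < 2 * |B| * (s * t) := by
  obtain ⟨x, hx0, hx⟩ := exists_real_balanced hB h
  obtain ⟨q, hq0, hq⟩ := (Rat.denseRange_cast (𝕜 := ℝ)).exists_mem_open
    (s := {t : ℝ | 0 < t ∧ |α + β * t ^ 2| < 2 * |B| * t})
    ((isOpen_lt continuous_const continuous_id).inter
      (isOpen_lt (f := fun t => |α + β * t ^ 2|) (g := fun t => 2 * |B| * t)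
        (by fun_prop) (by fun_prop))) ⟨x, hx0, hx⟩
  have hq0' : 0 < q := by exact_mod_cast hq0
  have hd : (0 : ℝ) < q.den := by exact_mod_cast q.den_pos
  refine ⟨q.den, q.num, by exact_mod_cast q.den_pos, Rat.num_pos.2 hq0', q.isCoprime_num_den.symm, ?_⟩
  · have e : (q : ℝ) = q.num / q.den := by exact_mod_cast (Rat.num_div_den q).symm
    have e' : (q.num : ℝ) = q * q.den := by rw [e]; field_simp
    push_cast
    rw [e', show α * (q.den : ℝ) ^ 2 + β * (q * q.den) ^ 2 = (α + β * q ^ 2) * (q.den : ℝ) ^ 2 by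
      ring, abs_mul, abs_of_pos (by positivity : (0 : ℝ) < (q.den : ℝ) ^ 2),
      show 2 * |B| * (q.den * (q * q.den)) = 2 * |B| * q * (q.den : ℝ) ^ 2 by ring]
    exact mul_lt_mul_of_pos_right hq (by positivity)

end UniversalCoxeter

namespace UniversalCoxeter

open Filter

theorem eventually_prodVec_mem_posRoots {v w : ℤ × ℤ} (h : det2 v w ^ 2 = 1) :
    ∀ᶠ k : ℤ in atTop, prodVec v (w + k • v) ∈ posRoots := by
  have hv : 1 ≤ v.1 * v.1 + v.2 * v.2 := by
    by_contra hcon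
    have h1 : v.1 = 0 := by nlinarith [mul_self_nonneg v.1, mul_self_nonneg v.2]
    have h2 : v.2 = 0 := by nlinarith [mul_self_nonneg v.1, mul_self_nonneg v.2]
    simp [det2, h1, h2] at h
  filter_upwards [eventually_ge_atTop (|v.1 * w.1 + v.2 * w.2| + 1)] with k hk
  refine prodVec_mem_posRoots ?_ ?_
  · rw [← h]
    simp only [det2, Prod.fst_add, Prod.snd_add, Prod.smul_fst, Prod.smul_snd, smul_eq_mul]
    ring
  · simp only [Prod.fst_add, Prod.snd_add, Prod.smul_fst, Prod.smul_snd, smul_eq_mul]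
    have h1 := neg_abs_le (v.1 * w.1 + v.2 * w.2)
    have h2 := abs_nonneg (v.1 * w.1 + v.2 * w.2)
    nlinarith [mul_le_mul_of_nonneg_left hv (by omega : 0 ≤ k)]

/-- Changing the sign of `b` affects only the mixed term of the product: the two roots differ by `2
* (s * r + t * p + 2 * k * (s * t))` times `prodVec a b`, and this factor is nonnegative for large
`k`. -/
theorem IsClosedSet.eventually_prodVec {S : Set V} (hS : IsClosedSet S) {a b : ℤ × ℤ}
    (hab : det2 a b ^ 2 = 1) (hm : prodVec a b ∈ S) {s t p r : ℤ} (hst : 0 < s * t)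
    (h : (s * r - t * p) ^ 2 = 1) : ∀ᶠ k : ℤ in atTop,
      prodVec (s • a - t • b) (p • a - r • b + k • (s • a - t • b)) ∈ S →
        prodVec (s • a + t • b) (p • a + r • b + k • (s • a + t • b)) ∈ S := by
  have hd : det2 (s • a + t • b) (p • a + r • b) ^ 2 = 1 := by
    have : det2 (s • a + t • b) (p • a + r • b) = (s * r - t * p) * det2 a b := by
      simp only [det2, Prod.fst_add, Prod.snd_add, Prod.smul_fst, Prod.smul_snd, smul_eq_mul]
      ring
    rw [this, mul_pow, h, hab, one_mul]
  filter_upwards [eventually_prodVec_mem_posRoots hd, eventually_ge_atTop |s * r + t * p|]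
    with k h2 hk h1
  have hc : 0 ≤ 2 * (s * r + t * p + 2 * k * (s * t)) := by
    have := neg_abs_le (s * r + t * p)
    have := abs_nonneg (s * r + t * p)
    nlinarith [mul_le_mul_of_nonneg_left (by omega : 1 ≤ s * t) (by omega : 0 ≤ k)]
  refine hS.mem h1 hm h2 one_pos zero_le_one
    (s := ((2 * (s * r + t * p + 2 * k * (s * t)) : ℤ) : ℝ)) (by exact_mod_cast hc) ?_
  apply vec_ext <;> simp [prodVec_zero, prodVec_one, prodVec_two] <;> ring

theorem exists_eq_smul_add_smul {a b : ℤ × ℤ} (h : det2 a b ^ 2 = 1) (w : ℤ × ℤ) :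
    ∃ p r : ℤ, w = p • a + r • b := by
  refine ⟨det2 w b * det2 a b, det2 a w * det2 a b, Prod.ext ?_ ?_⟩ <;>
    simp only [det2, Prod.fst_add, Prod.snd_add, Prod.smul_fst, Prod.smul_snd, smul_eq_mul] at h ⊢
  · linear_combination -w.1 * h
  · linear_combination -w.2 * h

namespace IsNormalized

variable {R : Set V} (hR : IsNormalized R)
include hR

/-- Write the root as `a * b`, with value `B ≠ 0`, and choose `s, t` so that the form has the sign
of `± B` at `s a ± t b`. If `B > 0` and `a * b ∈ R`, then `s a - t b` is deep and
`eventually_prodVec` makes `s a + t b` deep, a contradiction. If `B < 0` and `a * b ∉ R`, the same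
argument runs in the complement. -/
theorem sign_of_form {c₁ c₂ c₃ : ℝ} (hc : c₁ * c₃ < c₂ ^ 2)
    (hneg : ∀ v w, det2 v w ^ 2 = 1 → dotMap (polarCoeff c₁ c₂ c₃) (prodVec v v) < 0 → IsDeep R v)
    (hpos : ∀ v w, det2 v w ^ 2 = 1 →
      0 < dotMap (polarCoeff c₁ c₂ c₃) (prodVec v v) → ¬ IsDeep R v)
    {x : V} (hx : x ∈ posRoots) :
    (x ∈ R → dotMap (polarCoeff c₁ c₂ c₃) x ≤ 0) ∧
      (x ∉ R → 0 ≤ dotMap (polarCoeff c₁ c₂ c₃) x) := by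
  obtain ⟨a, b, hab, rfl⟩ := exists_prodVec_of_mem_roots hx.1
  set φ := dotMap (polarCoeff c₁ c₂ c₃) with hφ
  set B := φ (prodVec a b) with hB
  by_cases hB0 : B = 0
  · rw [hB0]; simp
  have hab' : ((a.1 : ℝ) * b.2 - a.2 * b.1) ^ 2 = 1 := by exact_mod_cast hab
  -- With `q` the quadratic form, `B ^ 2 - q(a) q(b) = (c₂ ^ 2 - c₁ * c₃) * det2 a b ^ 2`, which is
  -- positive.
  obtain ⟨s, t, hs, ht, hst, hbal⟩ := exists_coprime_balanced (α := φ (prodVec a a))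
    (β := φ (prodVec b b)) hB0 (by
      rw [hB]
      simp only [hφ, dotMap_polarCoeff]
      linear_combination hc + (c₁ * c₃ - c₂ ^ 2) * hab')
  have hsum : ∀ s t : ℤ, φ (prodVec (s • a + t • b) (s • a + t • b)) =
      φ (prodVec a a) * s ^ 2 + φ (prodVec b b) * t ^ 2 + 2 * B * (s * t) := by
    intro s t
    rw [hB]
    simp only [hφ, dotMap_polarCoeff]
    simp only [Prod.fst_add, Prod.snd_add, Prod.smul_fst, Prod.smul_snd, smul_eq_mul]
    push_cast
    ring
  have hsub : φ (prodVec (s • a - t • b) (s • a - t • b)) =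
      φ (prodVec a a) * s ^ 2 + φ (prodVec b b) * t ^ 2 - 2 * B * (s * t) := by
    have := hsum s (-t)
    rw [neg_smul, ← sub_eq_add_neg] at this
    rw [this]; push_cast; ring
  have hadd := hsum s t
  obtain ⟨hlo, hhi⟩ := abs_lt.1 hbal
  have hdet : ∀ s t p r : ℤ, det2 (s • a + t • b) (p • a + r • b) = (s * r - t * p) * det2 a b := by
    intro s t p r
    simp only [det2, Prod.fst_add, Prod.snd_add, Prod.smul_fst, Prod.smul_snd, smul_eq_mul]
    ring
  have hdet_add : ∀ p r : ℤ, det2 (s • a + t • b) (p • a + r • b) ^ 2 = (s * r - t * p) ^ 2 := by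
    intro p r
    rw [hdet, mul_pow, hab, mul_one]
  have hdet_sub : ∀ p r : ℤ, det2 (s • a - t • b) (p • a - r • b) ^ 2 = (s * r - t * p) ^ 2 := by
    intro p r
    have := hdet s (-t) p (-r)
    rw [neg_smul, neg_smul, ← sub_eq_add_neg, ← sub_eq_add_neg] at this
    rw [this, mul_pow, hab]; ring
  obtain ⟨u, u', hu⟩ := hst
  have hu' : (s * u - t * -u') ^ 2 = 1 := by
    rw [show s * u - t * -u' = u * s + u' * t by ring, hu]; norm_num
  rcases lt_or_gt_of_ne hB0 with hlt | hgt
  · refine ⟨fun _ => hlt.le, fun hm => ?_⟩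
    rw [abs_of_neg hlt] at hlo hhi
    have hdeep := hneg (s • a + t • b) _ ((hdet_add _ _).trans hu') (by rw [hadd]; linarith)
    have hnot := hpos (s • a - t • b) _ ((hdet_sub _ _).trans hu') (by rw [hsub]; linarith)
    simp only [IsDeep, not_forall] at hnot
    obtain ⟨w, hw, hfr⟩ := hnot
    obtain ⟨p, r, rfl⟩ := exists_eq_smul_add_smul hab w
    have hr : p • a + r • b = p • a - (-r) • b := by module
    rw [hr] at hw hfr
    have hpr := (hdet_sub p (-r)).symm.trans hw
    refine absurd ?_ hfr
    filter_upwards [hR.biclosed.2.eventually_prodVec hab ⟨hx, hm⟩ (mul_pos hs ht) hpr,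
      hdeep _ ((hdet_add p (-r)).trans hpr), eventually_prodVec_mem_posRoots hw] with k h1 h2 h3
    by_contra hcon
    exact (h1 ⟨h3, hcon⟩).2 h2
  · refine ⟨fun hm => ?_, fun _ => hgt.le⟩
    rw [abs_of_pos hgt] at hlo hhi
    have hdeep := hneg (s • a - t • b) _ ((hdet_sub _ _).trans hu') (by rw [hsub]; linarith)
    have hnot := hpos (s • a + t • b) _ ((hdet_add _ _).trans hu') (by rw [hadd]; linarith)
    simp only [IsDeep, not_forall] at hnot
    obtain ⟨w, hw, hfr⟩ := hnot
    obtain ⟨p, r, rfl⟩ := exists_eq_smul_add_smul hab w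
    have hpr := (hdet_add p r).symm.trans hw
    refine absurd ?_ hfr
    filter_upwards [hR.biclosed.1.eventually_prodVec hab hm (mul_pos hs ht) hpr,
      hdeep _ ((hdet_sub p r).trans hpr)] with k h1 h2
    exact h1 h2

/-- There is a functional that is nonpositive on `R` and nonnegative on the other positive roots. -/
theorem exists_functional_of_slope {c₁ c₂ c₃ : ℝ} (hc : c₁ * c₃ < c₂ ^ 2) (hc₁ : 0 ≤ c₁)
    (hneg : ∀ n i, c₁ * slope (fareyVertex n i) ^ 2 + 2 * c₂ * slope (fareyVertex n i) + c₃ < 0 →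
      IsDeep R (fareyVertex n i))
    (hpos : ∀ n i, 0 < c₁ * slope (fareyVertex n i) ^ 2 + 2 * c₂ * slope (fareyVertex n i) + c₃ →
      ¬ IsDeep R (fareyVertex n i)) :
    ∃ f : V, f ≠ 0 ∧ (∀ x ∈ R, dotMap f x ≤ 0) ∧ ∀ x ∈ posRoots \ R, 0 ≤ dotMap f x := by
  have hq : ∀ v : ℤ × ℤ, 0 < v.2 → dotMap (polarCoeff c₁ c₂ c₃) (prodVec v v) =
      (c₁ * slope v ^ 2 + 2 * c₂ * slope v + c₃) * (v.2 : ℝ) ^ 2 := by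
    intro v hv
    have : (v.2 : ℝ) ≠ 0 := by exact_mod_cast hv.ne'
    rw [dotMap_polarCoeff, slope]
    field_simp
    ring
  have hqneg : ∀ v : ℤ × ℤ, prodVec (-v) (-v) = prodVec v v := by
    intro v
    apply vec_ext <;> simp [prodVec_zero, prodVec_one, prodVec_two]
    ring
  have hsq : ∀ v : ℤ × ℤ, 0 < v.2 → (0 : ℝ) < (v.2 : ℝ) ^ 2 := fun v hv =>
    pow_pos (by exact_mod_cast hv) 2
  have hdneg : ∀ v w, det2 (-v) w ^ 2 = det2 v w ^ 2 := by
    intro v w; simp only [det2, Prod.fst_neg, Prod.snd_neg]; ring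
  have hsign := @sign_of_form R hR c₁ c₂ c₃ hc ?_ ?_
  · refine ⟨polarCoeff c₁ c₂ c₃, fun h => ?_, fun x hx => (hsign (hR.biclosed.subset hx)).1 hx,
      fun x hx => (hsign hx.1).2 hx.2⟩
    have h0 := congrFun h 0
    have h2 := congrFun h 2
    simp only [polarCoeff, Matrix.cons_val, Pi.zero_apply] at h0 h2
    have h3 : c₂ = 0 := by linarith
    have h4 : c₃ = 0 := by linarith
    rw [h3, h4] at hc; norm_num at hc
  · intro v w hvw hlt
    rcases lt_trichotomy v.2 0 with hv | hv | hv
    · obtain ⟨n, i, hi⟩ := exists_eq_fareyVertex ((hdneg v w).trans hvw) (by simpa using hv)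
      rw [← hqneg, hq (-v) (by simpa using hv)] at hlt
      have := neg_of_mul_neg_left hlt (hsq (-v) (by simpa using hv)).le
      rw [← neg_neg v]
      rw [hi] at this ⊢
      exact (hneg n i this).neg
    -- At ∞ the form has the value `c₁ * v.1 ^ 2`, nonnegative by `hc₁`.
    · exfalso
      rw [dotMap_polarCoeff, hv] at hlt
      simp at hlt
      nlinarith [mul_nonneg hc₁ (mul_self_nonneg (v.1 : ℝ))]
    · obtain ⟨n, i, hi⟩ := exists_eq_fareyVertex hvw hv
      rw [hq v hv] at hlt
      have := neg_of_mul_neg_left hlt (hsq v hv).le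
      rw [hi] at this ⊢
      exact hneg n i this
  · intro v w hvw hlt
    rcases lt_trichotomy v.2 0 with hv | hv | hv
    · obtain ⟨n, i, hi⟩ := exists_eq_fareyVertex ((hdneg v w).trans hvw) (by simpa using hv)
      rw [← hqneg, hq (-v) (by simpa using hv)] at hlt
      have := pos_of_mul_pos_left hlt (hsq (-v) (by simpa using hv)).le
      intro hd
      have hd' := hd.neg
      rw [hi] at this hd'
      exact hpos n i this hd'
    · exact hR.not_isDeep_of_snd_eq_zero hvw hv
    · obtain ⟨n, i, hi⟩ := exists_eq_fareyVertex hvw hv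
      rw [hq v hv] at hlt
      have := pos_of_mul_pos_left hlt (hsq v hv).le
      rw [hi] at this ⊢
      exact hpos n i this

end IsNormalized

end UniversalCoxeter

namespace UniversalCoxeter

open Filter

/-! ### The separating functional of a normalized set. -/

theorem eq_fareyEdge_of_mem_posRoots {x : V} (hx : x ∈ posRoots) (h0 : x 0 ≠ 0) :
    ∃ n i, x = fareyEdge n i := by
  obtain ⟨a, b, hab, rfl⟩ := exists_prodVec_of_mem_roots hx.1
  have h0' : (0 : ℝ) < ((a.2 * b.2 : ℤ) : ℝ) := by
    have := lt_of_le_of_ne (nonneg_of_mem_posRoots hx 0) h0.symm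
    rw [prodVec_zero] at this
    exact_mod_cast this
  have hpos : 0 < a.2 * b.2 := by exact_mod_cast h0'
  have key : ∀ a b : ℤ × ℤ, det2 a b ^ 2 = 1 → 0 < a.2 → 0 < b.2 →
      ∃ n i, prodVec a b = fareyEdge n i := by
    intro a b hab ha hb
    rcases sq_eq_one_iff.1 hab with h | h
    · obtain ⟨n, i, h1, h2⟩ := exists_eq_fareyEdge (a := b) (b := a) (by rw [det2_swap, h]) hb ha
      exact ⟨n, i, by rw [prodVec_comm, fareyEdge, h1, h2]⟩
    · obtain ⟨n, i, h1, h2⟩ := exists_eq_fareyEdge h ha hb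
      exact ⟨n, i, by rw [fareyEdge, ← h1, ← h2]⟩
  rcases mul_pos_iff.1 hpos with ⟨ha, hb⟩ | ⟨ha, hb⟩
  · exact key a b hab ha hb
  · obtain ⟨n, i, h⟩ := key (-a) (-b)
      (by rw [← hab]; simp only [det2, Prod.fst_neg, Prod.snd_neg]; ring)
      (by simpa using ha) (by simpa using hb)
    refine ⟨n, i, h ▸ ?_⟩
    apply vec_ext <;> simp [prodVec_zero, prodVec_one, prodVec_two]
    ring

theorem exists_slope_le_lt (n m : ℕ) (j : ℤ) : ∃ l, slope (fareyVertex n l) ≤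
    slope (fareyVertex m j) ∧ slope (fareyVertex m j) < slope (fareyVertex n (l + 1)) := by
  have hp : (0 : ℤ) < 2 ^ m := by positivity
  have h1 := Int.emod_add_mul_ediv (2 ^ n * j) (2 ^ m)
  have h2 := Int.emod_nonneg (2 ^ n * j) hp.ne'
  have h3 := Int.emod_lt_of_pos (2 ^ n * j) hp
  -- At level `n + m` the given vertex has index `2 ^ n * j`, and the vertices of level `n` have the
  -- multiples of `2 ^ m`.
  refine ⟨2 ^ n * j / 2 ^ m, ?_, ?_⟩
  · rw [← fareyVertex_pow n m, ← fareyVertex_pow m n, add_comm m n,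
      (slope_fareyVertex_strictMono _).le_iff_le]
    linarith
  · rw [← fareyVertex_pow n m, ← fareyVertex_pow m n, add_comm m n,
      (slope_fareyVertex_strictMono _).lt_iff_lt]
    linarith

namespace IsNormalized

variable {R : Set V} (hR : IsNormalized R)
include hR

theorem exists_functional_of_edges {c₁ c₂ c₃ : ℝ} (hc : polarCoeff c₁ c₂ c₃ ≠ 0)
    (hneg : ∀ n, ∀ i ∈ levelSet R n, dotMap (polarCoeff c₁ c₂ c₃) (fareyEdge n i) ≤ 0)
    (hpos : ∀ n, ∀ i ∉ levelSet R n, 0 ≤ dotMap (polarCoeff c₁ c₂ c₃) (fareyEdge n i))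
    (hzero : ∀ x ∈ posRoots, x 0 = 0 → 0 ≤ dotMap (polarCoeff c₁ c₂ c₃) x) :
    ∃ f : V, f ≠ 0 ∧ (∀ x ∈ R, dotMap f x ≤ 0) ∧ ∀ x ∈ posRoots \ R, 0 ≤ dotMap f x := by
  refine ⟨_, hc, fun x hx => ?_, fun x hx => ?_⟩
  · have hx' := hR.biclosed.subset hx
    obtain ⟨n, i, rfl⟩ := eq_fareyEdge_of_mem_posRoots hx'
      fun h0 => hR.notMem_of_coord_eq_zero hx' h0 hx
    exact hneg n i hx
  · by_cases h0 : x 0 = 0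
    · exact hzero x hx.1 h0
    · obtain ⟨n, i, rfl⟩ := eq_fareyEdge_of_mem_posRoots hx.1 h0
      exact hpos n i hx.2

/-- A missing edge of level `0` is followed, away from the edge `0`, only by missing edges, and a
vertex between two of these is not deep. -/
theorem levelSet_eq_univ (h : ∀ n i, IsDeep R (fareyVertex n i)) (n : ℕ) (i : ℤ) :
    i ∈ levelSet R n := by
  induction n generalizing i with
  | zero =>
    by_contra hi
    rcases le_total 0 i with h0 | h0
    · refine hR.not_isDeep_of_notMem (n := 0) (i := i + 1) (by simpa using hi) (fun hk => hi ?_)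
        (h _ _)
      exact hR.levelSet_convex 0 h0 (by omega) hR.zero_mem hk
    · refine hR.not_isDeep_of_notMem (n := 0) (i := i) (fun hk => hi ?_) hi (h _ _)
      exact hR.levelSet_convex 0 (by omega) h0 hk hR.zero_mem
  | succ n ih =>
    rcases Int.even_or_odd' i with ⟨j, rfl | rfl⟩
    · exact (hR.split_mem (ih _) (ih j)).2
    · have := (hR.split_mem (ih (j + 1 - 1)) (ih (j + 1))).1
      rwa [show 2 * (j + 1) - 1 = 2 * j + 1 by ring] at this

/-- The functional is minus the coordinate `0`: negative on all edges with finite ends, zero on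
those at ∞. -/
theorem exists_functional_of_isDeep (h : ∀ n i, IsDeep R (fareyVertex n i)) :
    ∃ f : V, f ≠ 0 ∧ (∀ x ∈ R, dotMap f x ≤ 0) ∧ ∀ x ∈ posRoots \ R, 0 ≤ dotMap f x := by
  refine hR.exists_functional_of_edges (c₁ := 0) (c₂ := 0) (c₃ := -1) (fun h0 => ?_)
    (fun n i _ => ?_) (fun n i hi => absurd (hR.levelSet_eq_univ h n i) hi) (fun x _ h0 => ?_)
  · simpa [polarCoeff] using congrFun h0 0
  · rw [fareyEdge, dotMap_polarCoeff]
    have h1 : (0 : ℝ) < (fareyVertex n i).2 := by exact_mod_cast fareyVertex_snd_pos n i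
    have h2 : (0 : ℝ) < (fareyVertex n (i + 1)).2 := by
      exact_mod_cast fareyVertex_snd_pos n (i + 1)
    nlinarith [mul_pos h1 h2]
  · rw [dotMap_apply, h0]; simp [polarCoeff]

/-- The functional is the polarization of the square form `(x - z y)²`; on an edge it has the sign
of the product of the differences between the end slopes and `z`. -/
theorem exists_functional_of_point {z : ℝ}
    (h1 : ∀ n, ∀ i ∈ levelSet R n, slope (fareyVertex n i) ≤ z ∧ z ≤ slope (fareyVertex n (i + 1)))
    (h2 : ∀ n i, slope (fareyVertex n i) < z → z < slope (fareyVertex n (i + 1)) →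
      i ∈ levelSet R n) :
    ∃ f : V, f ≠ 0 ∧ (∀ x ∈ R, dotMap f x ≤ 0) ∧ ∀ x ∈ posRoots \ R, 0 ≤ dotMap f x := by
  have hφ : ∀ n i, ∃ r : ℝ, 0 < r ∧ dotMap (polarCoeff 1 (-z) (z ^ 2)) (fareyEdge n i) =
      r * ((slope (fareyVertex n i) - z) * (slope (fareyVertex n (i + 1)) - z)) := by
    intro n i
    have h1 : (0 : ℝ) < (fareyVertex n i).2 := by exact_mod_cast fareyVertex_snd_pos n i
    have h2 : (0 : ℝ) < (fareyVertex n (i + 1)).2 := by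
      exact_mod_cast fareyVertex_snd_pos n (i + 1)
    refine ⟨_, mul_pos h1 h2, ?_⟩
    rw [fareyEdge, dotMap_polarCoeff, slope, slope]
    field_simp
    ring
  refine hR.exists_functional_of_edges (c₁ := 1) (c₂ := -z) (c₃ := z ^ 2) (fun h0 => ?_)
    (fun n i hi => ?_) (fun n i hi => ?_) (fun x hx h0 => ?_)
  · have e1 := congrFun h0 1
    have e2 := congrFun h0 2
    simp [polarCoeff] at e1 e2
    linarith
  · obtain ⟨r, hr, e⟩ := hφ n i
    rw [e]
    have := h1 n i hi
    exact mul_nonpos_of_nonneg_of_nonpos hr.le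
      (mul_nonpos_of_nonpos_of_nonneg (by linarith) (by linarith))
  · obtain ⟨r, hr, e⟩ := hφ n i
    rw [e]
    have hlt : slope (fareyVertex n i) < slope (fareyVertex n (i + 1)) :=
      slope_fareyVertex_strictMono n (by omega : i < i + 1)
    refine mul_nonneg hr.le ?_
    by_cases h : slope (fareyVertex n i) < z
    · have : ¬ z < slope (fareyVertex n (i + 1)) := fun h' => hi (h2 n i h h')
      exact mul_nonneg_of_nonpos_of_nonpos (by linarith) (by linarith)
    · exact mul_nonneg (by linarith) (by linarith)
  -- The edge from 0 to 1 lies in `R`, so `0 ≤ z ≤ 1`, which settles the edges at ∞.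
  · have hz := h1 0 0 hR.zero_mem
    simp [slope, fareyVertex_zero] at hz
    have p1 := nonneg_of_mem_posRoots hx 1
    have p2 := nonneg_of_mem_posRoots hx 2
    rw [dotMap_apply, h0]
    simp only [polarCoeff, Matrix.cons_val]
    nlinarith [mul_nonneg p1 (by linarith : 0 ≤ 1 - z), mul_nonneg p2 hz.1]

/-- If a child of a missing edge were in `R`, the closure rule for the complement would put the next
edge at their common old end into `R` too, making that end deep. -/
theorem notMem_succ_of_not_isDeep {n : ℕ} {i : ℤ} (hi : i ∉ levelSet R n)
    (h1 : ¬ IsDeep R (fareyVertex n i)) (h2 : ¬ IsDeep R (fareyVertex n (i + 1))) :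
    2 * i ∉ levelSet R (n + 1) ∧ 2 * i + 1 ∉ levelSet R (n + 1) := by
  constructor
  · intro h
    have := hR.isDeep_of_mem (hR.right_notMem hi h) h
    rw [fareyVertex_even] at this
    exact h1 this
  · intro h
    rw [show 2 * i + 1 = 2 * (i + 1) - 1 by ring] at h
    have := hR.isDeep_of_mem h (hR.left_notMem (by simpa using hi) h)
    rw [fareyVertex_even] at this
    exact h2 this

/-- Below an edge outside `R` with ends that are not deep, nothing is in `R`. -/
theorem notMem_of_not_isDeep {n : ℕ} {i : ℤ} (hi : i ∉ levelSet R n)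
    (h1 : ¬ IsDeep R (fareyVertex n i)) (h2 : ¬ IsDeep R (fareyVertex n (i + 1)))
    (k : ℕ) {j : ℤ} (hj1 : 2 ^ k * i ≤ j) (hj2 : j < 2 ^ k * (i + 1)) :
    j ∉ levelSet R (n + k) ∧ ¬ IsDeep R (fareyVertex (n + k) j) ∧
      ¬ IsDeep R (fareyVertex (n + k) (j + 1)) := by
  induction k generalizing j with
  | zero =>
    obtain rfl : i = j := by simp at hj1 hj2; omega
    exact ⟨hi, h1, h2⟩
  | succ k ih =>
    rw [pow_succ', mul_assoc] at hj1 hj2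
    rw [← add_assoc]
    obtain ⟨l, hl⟩ := Int.even_or_odd' j
    have hl' := ih (j := l) (by omega) (by omega)
    have hc := hR.notMem_succ_of_not_isDeep hl'.1 hl'.2.1 hl'.2.2
    have hm : ¬ IsDeep R (fareyVertex (n + k + 1) (2 * l + 1)) :=
      hR.not_isDeep_of_notMem (by simpa using hc.1) hc.2
    rcases hl with rfl | rfl
    · exact ⟨hc.1, by rw [fareyVertex_even]; exact hl'.2.1, hm⟩
    · refine ⟨hc.2, hm, ?_⟩
      rw [show 2 * l + 1 + 1 = 2 * (l + 1) by ring, fareyVertex_even]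
      exact hl'.2.2

theorem not_isDeep_of_slope_mem {n m : ℕ} {i j : ℤ} (hi : i ∉ levelSet R n)
    (h1 : ¬ IsDeep R (fareyVertex n i)) (h2 : ¬ IsDeep R (fareyVertex n (i + 1)))
    (hj1 : slope (fareyVertex n i) ≤ slope (fareyVertex m j))
    (hj2 : slope (fareyVertex m j) < slope (fareyVertex n (i + 1))) :
    ¬ IsDeep R (fareyVertex m j) := by
  rw [← fareyVertex_pow n m, ← fareyVertex_pow m n, add_comm m n] at hj1 hj2
  rw [← fareyVertex_pow m n, add_comm m n]
  exact (hR.notMem_of_not_isDeep hi h1 h2 m ((slope_fareyVertex_strictMono _).le_iff_le.1 hj1)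
    ((slope_fareyVertex_strictMono _).lt_iff_lt.1 hj2)).2.1

theorem exists_functional_of_unique_isDeep {m : ℕ} {j : ℤ} (hd : IsDeep R (fareyVertex m j))
    (huniq : ∀ n i, IsDeep R (fareyVertex n i) →
      slope (fareyVertex n i) = slope (fareyVertex m j)) :
    ∃ f : V, f ≠ 0 ∧ (∀ x ∈ R, dotMap f x ≤ 0) ∧ ∀ x ∈ posRoots \ R, 0 ≤ dotMap f x := by
  set z := slope (fareyVertex m j) with hz
  have hstrict : ∀ n i, slope (fareyVertex n i) < z → z < slope (fareyVertex n (i + 1)) →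
      i ∈ levelSet R n := by
    intro n i h1 h2
    by_contra hi
    exact hR.not_isDeep_of_slope_mem hi (fun h => h1.ne (huniq _ _ h))
      (fun h => h2.ne' (huniq _ _ h)) h1.le h2 hd
  have hex : ∀ n, ∃ l ∈ levelSet R n, slope (fareyVertex n l) ≤ z ∧
      z ≤ slope (fareyVertex n (l + 1)) := by
    intro n
    obtain ⟨l, h1, h2⟩ := exists_slope_le_lt n m j
    rcases h1.lt_or_eq with h1' | h1'
    · exact ⟨l, hstrict n l h1' h2, h1, h2.le⟩
    · rw [← eq_of_slope_fareyVertex_eq h1'] at hd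
      by_cases hl : l ∈ levelSet R n
      · exact ⟨l, hl, h1, h2.le⟩
      · by_cases hl' : l - 1 ∈ levelSet R n
        · refine ⟨l - 1, hl', ?_, ?_⟩
          · exact ((slope_fareyVertex_strictMono n).monotone (by omega : l - 1 ≤ l)).trans h1
          · rw [sub_add_cancel]; exact h1'.ge
        · exact absurd hd (hR.not_isDeep_of_notMem hl' hl)
  refine hR.exists_functional_of_point (z := z) (fun n i hi => ?_) hstrict
  obtain ⟨l, hl, h1, h2⟩ := hex n
  have mono := (slope_fareyVertex_strictMono n).monotone
  -- A second edge of `R` on this level makes an end of the edge `i` deep, so that end has slope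
  -- `z`.
  rcases lt_trichotomy i l with hil | rfl | hil
  · have h3 := huniq _ _ (hR.isDeep_of_mem (i := i + 1) (by simpa using hi)
      (hR.levelSet_convex n (by omega) (by omega) hi hl))
    exact ⟨(mono (by omega : i ≤ i + 1)).trans h3.le, h3.ge⟩
  · exact ⟨h1, h2⟩
  · have h3 := huniq _ _ (hR.isDeep_of_mem (i := i)
      (hR.levelSet_convex n (by omega) (by omega) hl hi) hi)
    exact ⟨h3.le, h3.ge.trans (mono (by omega : i ≤ i + 1))⟩

/-- Two edges of `R` on one level would produce a deep vertex, so there is at most one per level.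
These are nested, and `z` is the supremum of their left ends. -/
theorem exists_functional_of_not_isDeep (hd : ∀ n i, ¬ IsDeep R (fareyVertex n i)) :
    ∃ f : V, f ≠ 0 ∧ (∀ x ∈ R, dotMap f x ≤ 0) ∧ ∀ x ∈ posRoots \ R, 0 ≤ dotMap f x := by
  have huniq : ∀ n i j, i ∈ levelSet R n → j ∈ levelSet R n → ¬ i < j := by
    intro n i j hi hj hij
    exact hd _ _ (hR.isDeep_of_mem (i := i + 1) (by simpa using hi)
      (hR.levelSet_convex n (by omega) (by omega) hi hj))
  have hchild : ∀ n k i j, i ∉ levelSet R n → 2 ^ k * i ≤ j → j < 2 ^ k * (i + 1) →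
      j ∉ levelSet R (n + k) := fun n k i j hi h1 h2 =>
    (hR.notMem_of_not_isDeep hi (hd _ _) (hd _ _) k h1 h2).1
  have hanc : ∀ n k i j, i ∈ levelSet R n → j ∈ levelSet R (n + k) →
      2 ^ k * i ≤ j ∧ j < 2 ^ k * (i + 1) := by
    intro n k i j hi hj
    have hp : (0 : ℤ) < 2 ^ k := by positivity
    have h1 := Int.emod_add_mul_ediv j (2 ^ k)
    have h2 := Int.emod_nonneg j hp.ne'
    have h3 := Int.emod_lt_of_pos j hp
    have h4 : 2 ^ k * (j / 2 ^ k) ≤ j := by linarith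
    have h5 : j < 2 ^ k * (j / 2 ^ k + 1) := by linarith
    have h6 : j / 2 ^ k ∈ levelSet R n := by
      by_contra h
      exact hchild n k _ j h h4 h5 hj
    have h7 : i = j / 2 ^ k := by
      have := huniq n i _ hi h6
      have := huniq n _ i h6 hi
      omega
    rw [h7]; exact ⟨h4, h5⟩
  set L : Set ℝ := {s | ∃ n, ∃ i ∈ levelSet R n, s = slope (fareyVertex n i)} with hL
  have hmono := slope_fareyVertex_strictMono
  have hle : ∀ n m i j, i ∈ levelSet R n → j ∈ levelSet R m →
      slope (fareyVertex n i) ≤ slope (fareyVertex m (j + 1)) := by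
    intro n m i j hi hj
    rcases le_total n m with h | h
    · obtain ⟨k, rfl⟩ := Nat.exists_eq_add_of_le h
      rw [← fareyVertex_pow n k, (hmono _).le_iff_le]
      have := hanc n k i j hi hj
      omega
    · obtain ⟨k, rfl⟩ := Nat.exists_eq_add_of_le h
      rw [← fareyVertex_pow m k, (hmono _).le_iff_le]
      have := hanc m k j i hj hi
      omega
  have hbdd : BddAbove L := by
    refine ⟨slope (fareyVertex 0 (0 + 1)), ?_⟩
    rintro _ ⟨n, i, hi, rfl⟩
    exact hle n 0 i 0 hi hR.zero_mem
  have hne : L.Nonempty := ⟨_, 0, 0, hR.zero_mem, rfl⟩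
  refine hR.exists_functional_of_point (z := sSup L) (fun n i hi => ⟨le_csSup hbdd ⟨n, i, hi, rfl⟩,
    csSup_le hne ?_⟩) (fun n i h1 h2 => ?_)
  · rintro _ ⟨m, j, hj, rfl⟩
    exact hle m n j i hj hi
  · by_contra hi
    obtain ⟨_, ⟨m, j, hj, rfl⟩, h3⟩ := exists_lt_of_lt_csSup hne h1
    have h4 := (le_csSup hbdd ⟨m, j, hj, rfl⟩).trans_lt h2
    rcases le_total n m with h | h
    · obtain ⟨k, rfl⟩ := Nat.exists_eq_add_of_le h
      rw [← fareyVertex_pow n k, (hmono _).lt_iff_lt] at h3 h4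
      exact hchild n k i j hi h3.le h4 hj
    · obtain ⟨k, rfl⟩ := Nat.exists_eq_add_of_le h
      rw [← fareyVertex_pow m k, (hmono _).lt_iff_lt] at h3 h4
      omega

/-- With at least two deep slopes, the form in the slope `t` is `(t - x) * (t - y)`, `t - y` or `x -
t`, where `x` and `y` are the infimum and supremum of the deep slopes when finite. It is negative
strictly inside, and `x < y` makes the first one indefinite. Having the sign of the form at the ends
zero leaves their deepness undecided. -/
theorem exists_functional :
    ∃ f : V, f ≠ 0 ∧ (∀ x ∈ R, dotMap f x ≤ 0) ∧ ∀ x ∈ posRoots \ R, 0 ≤ dotMap f x := by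
  by_cases hd : ∀ n i, ¬ IsDeep R (fareyVertex n i)
  · exact hR.exists_functional_of_not_isDeep hd
  push Not at hd
  obtain ⟨m, j, hj⟩ := hd
  by_cases huniq : ∀ n i, IsDeep R (fareyVertex n i) →
      slope (fareyVertex n i) = slope (fareyVertex m j)
  · exact hR.exists_functional_of_unique_isDeep hj huniq
  push Not at huniq
  obtain ⟨m', j', hj', hne⟩ := huniq
  set D : Set ℝ := {s | ∃ n i, IsDeep R (fareyVertex n i) ∧ s = slope (fareyVertex n i)}
  have hm : slope (fareyVertex m j) ∈ D := ⟨m, j, hj, rfl⟩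
  have hm' : slope (fareyVertex m' j') ∈ D := ⟨m', j', hj', rfl⟩
  have hnD : D.Nonempty := ⟨_, hm⟩
  have hmem : ∀ n i, slope (fareyVertex n i) ∈ D → IsDeep R (fareyVertex n i) := by
    rintro n i ⟨n', i', h, e⟩
    rwa [eq_of_slope_fareyVertex_eq e]
  have hconv : ∀ n i, (∃ s ∈ D, s < slope (fareyVertex n i)) →
      (∃ s ∈ D, slope (fareyVertex n i) < s) → IsDeep R (fareyVertex n i) := by
    rintro n i ⟨_, ⟨n₁, i₁, h1, rfl⟩, hlt⟩ ⟨_, ⟨n₂, i₂, h2, rfl⟩, hlt'⟩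
    exact hR.isDeep_convex hlt hlt' h1 h2
  have habove : ¬ BddAbove D → ∀ r, ∃ s ∈ D, r < s := not_bddAbove_iff.1
  have hbelow : ¬ BddBelow D → ∀ r, ∃ s ∈ D, s < r := not_bddBelow_iff.1
  by_cases hA : BddAbove D <;> by_cases hB : BddBelow D
  · set x := sInf D
    set y := sSup D
    have hxy : x < y := by
      have := csInf_le hB hm
      have := csInf_le hB hm'
      have := le_csSup hA hm
      have := le_csSup hA hm'
      rcases lt_or_gt_of_ne hne with h | h <;> linarith
    refine hR.exists_functional_of_slope (c₁ := 1) (c₂ := -(x + y) / 2) (c₃ := x * y) ?_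
      zero_le_one (fun n i h => ?_) (fun n i h hdeep => ?_)
    · nlinarith [mul_pos (sub_pos.2 hxy) (sub_pos.2 hxy)]
    · have h' : (slope (fareyVertex n i) - x) * (slope (fareyVertex n i) - y) < 0 := by linarith
      refine hconv n i (exists_lt_of_csInf_lt hnD ?_) (exists_lt_of_lt_csSup hnD ?_)
      · rcases mul_neg_iff.1 h' with ⟨h1, h2⟩ | ⟨h1, h2⟩ <;> change x < _ <;> linarith
      · rcases mul_neg_iff.1 h' with ⟨h1, h2⟩ | ⟨h1, h2⟩ <;> change _ < y <;> linarith
    · have h1 : x ≤ slope (fareyVertex n i) := csInf_le hB ⟨n, i, hdeep, rfl⟩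
      have h2 : slope (fareyVertex n i) ≤ y := le_csSup hA ⟨n, i, hdeep, rfl⟩
      nlinarith [mul_nonneg (sub_nonneg.2 h1) (sub_nonneg.2 h2)]
  · refine hR.exists_functional_of_slope (c₁ := 0) (c₂ := 1 / 2) (c₃ := -sSup D) (by norm_num)
      le_rfl (fun n i h => ?_) (fun n i h hdeep => ?_)
    · exact hconv n i (hbelow hB _) (exists_lt_of_lt_csSup hnD (by linarith))
    · have h2 : slope (fareyVertex n i) ≤ sSup D := le_csSup hA ⟨n, i, hdeep, rfl⟩
      linarith
  · refine hR.exists_functional_of_slope (c₁ := 0) (c₂ := -1 / 2) (c₃ := sInf D) (by norm_num)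
      le_rfl (fun n i h => ?_) (fun n i h hdeep => ?_)
    · exact hconv n i (exists_lt_of_csInf_lt hnD (by linarith)) (habove hA _)
    · have h2 : sInf D ≤ slope (fareyVertex n i) := csInf_le hB ⟨n, i, hdeep, rfl⟩
      linarith
  · exact hR.exists_functional_of_isDeep fun n i => hconv n i (hbelow hB _) (habove hA _)

end IsNormalized

/-! ### Weak separability of all biclosed sets -/

theorem simpleRoot_comp (i : Fin 3) (e : Equiv.Perm (Fin 3)) :
    simpleRoot i ∘ e = simpleRoot (e.symm i) := by
  ext j
  simp [simpleRoot_apply, Equiv.eq_symm_apply, eq_comm]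

theorem comp_mem_posRoots_iff (e : Equiv.Perm (Fin 3)) {x : V} :
    x ∘ e ∈ posRoots ↔ x ∈ posRoots := by
  have key : ∀ (e : Equiv.Perm (Fin 3)) (x : V), x ∈ posRoots → x ∘ e ∈ posRoots := by
    intro e x hx
    obtain ⟨y, h1, h2, rfl⟩ := mem_posRoots_iff.1 hx
    refine mem_posRoots_iff.2 ⟨y ∘ e, ?_, fun i => h2 _, rfl⟩
    have hn : ∀ y, normForm y = 2 * ∑ i, y i ^ 2 - (∑ i, y i) ^ 2 := fun y => by
      rw [Fin.sum_univ_three, Fin.sum_univ_three]; rfl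
    rw [← h1, hn, hn]
    simp only [Function.comp_apply, Equiv.sum_comp e fun i => y i ^ 2, Equiv.sum_comp e y]
  refine ⟨fun h => ?_, key e x⟩
  have := key e.symm _ h
  rwa [Function.comp_assoc, Equiv.self_comp_symm, Function.comp_id] at this

theorem IsClosedSet.comp {S : Set V} (hS : IsClosedSet S) (e : Equiv.Perm (Fin 3)) :
    IsClosedSet {x | x ∘ e ∈ S} := by
  refine ⟨fun x hx => (comp_mem_posRoots_iff e).1 (hS.1 hx), ?_⟩
  rintro α hα β hβ x ⟨hx, hx'⟩
  refine hS.2 _ hα _ hβ ⟨?_, (comp_mem_posRoots_iff e).2 hx'⟩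
  refine nonnegSpan_induction (p := fun x => x ∘ e ∈ nonnegSpan {α ∘ e, β ∘ e})
    (fun x hx => subset_nonnegSpan _ ?_) (zero_mem_nonnegSpan _) (fun _ _ => add_mem_nonnegSpan)
    (fun _ hr _ => smul_mem_nonnegSpan hr) x hx
  rcases hx with rfl | rfl
  · exact Or.inl rfl
  · exact Or.inr rfl

theorem IsBiclosed.comp {R : Set V} (hR : IsBiclosed R) (e : Equiv.Perm (Fin 3)) :
    IsBiclosed {x | x ∘ e ∈ R} := by
  refine ⟨hR.1.comp e, ?_⟩
  have : posRoots \ {x | x ∘ e ∈ R} = {x | x ∘ e ∈ posRoots \ R} := by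
    ext x
    simp [comp_mem_posRoots_iff]
  rw [this]
  exact hR.2.comp e

theorem dotMap_comp (f x : V) (e : Equiv.Perm (Fin 3)) :
    dotMap (f ∘ e) (x ∘ e) = dotMap f x := by
  have h : ∀ f x : V, dotMap f x = ∑ i, f i * x i := fun f x => by
    rw [dotMap_apply, Fin.sum_univ_three]
  rw [h, h]
  exact Equiv.sum_comp e fun i => f i * x i

/-- Permuting coordinates preserves the positive roots, so a transposition normalizes `R`. -/
theorem separated_of_unique_simpleRoot {R : Set V} (hR : IsBiclosed R) {i : Fin 3}
    (hi : simpleRoot i ∈ R) (hj : ∀ j ≠ i, simpleRoot j ∉ R) :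
    nonnegSpan R ∩ nonnegSpan (posRoots \ R) ⊆ {0} := by
  set e : Equiv.Perm (Fin 3) := Equiv.swap 0 i
  have hinv : ∀ x : V, (x ∘ e) ∘ e = x := fun x => by
    ext k; simp [e]
  have hs : ∀ j, simpleRoot j ∘ e = simpleRoot (e j) := fun j => simpleRoot_comp j e
  have hN : IsNormalized {x | x ∘ e ∈ R} := by
    refine ⟨hR.comp e, ?_, ?_, ?_⟩
    · change simpleRoot 0 ∘ e ∈ R
      rw [hs, Equiv.swap_apply_left]; exact hi
    · change simpleRoot 1 ∘ e ∉ R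
      rw [hs]
      refine hj _ fun h => ?_
      rw [← Equiv.swap_apply_left 0 i] at h
      exact absurd (e.injective h) (by decide)
    · change simpleRoot 2 ∘ e ∉ R
      rw [hs]
      refine hj _ fun h => ?_
      rw [← Equiv.swap_apply_left 0 i] at h
      exact absurd (e.injective h) (by decide)
  obtain ⟨f, hf, h1, h2⟩ := hN.exists_functional
  have hd : ∀ x, dotMap (f ∘ e) x = dotMap f (x ∘ e) := fun x => by
    rw [← dotMap_comp _ _ e, hinv]
  refine separated_of_functional hR (f := f ∘ e) (fun h => hf ?_) (fun x hx => ?_) (fun x hx => ?_)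
  · rw [← hinv f, h]; rfl
  · rw [hd]
    exact h1 _ (by change (x ∘ e) ∘ e ∈ R; rwa [hinv])
  · rw [hd]
    exact h2 _ ⟨(comp_mem_posRoots_iff e).2 hx.1, by change (x ∘ e) ∘ e ∉ R; rw [hinv]; exact hx.2⟩

/-- By the number of simple roots in `R`: three or none make `R` everything or empty, one is
`separated_of_unique_simpleRoot`, and two is that case for the complement. -/
theorem IsBiclosed.separated {R : Set V} (hR : IsBiclosed R) :
    nonnegSpan R ∩ nonnegSpan (posRoots \ R) ⊆ {0} := by
  have hnil : ∀ S : Set V, S = ∅ → nonnegSpan S ⊆ {0} := by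
    rintro S rfl
    simp [nonnegSpan]
  have hcompl : ∀ i, simpleRoot i ∈ posRoots \ R ↔ simpleRoot i ∉ R := fun i =>
    ⟨fun h => h.2, fun h => ⟨simpleRoot_mem_posRoots i, h⟩⟩
  have key : ∀ i, (simpleRoot i ∈ R ∧ ∀ j ≠ i, simpleRoot j ∉ R) ∨
      (simpleRoot i ∉ R ∧ ∀ j ≠ i, simpleRoot j ∈ R) →
      nonnegSpan R ∩ nonnegSpan (posRoots \ R) ⊆ {0} := by
    rintro i (⟨h1, h2⟩ | ⟨h1, h2⟩)
    · exact separated_of_unique_simpleRoot hR h1 h2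
    · have := separated_of_unique_simpleRoot hR.compl ((hcompl i).2 h1)
        fun j hj h => h.2 (h2 j hj)
      rwa [Set.sdiff_sdiff_cancel_left hR.subset, Set.inter_comm] at this
  have hfin : ∀ p : Fin 3 → Prop, p 0 → p 1 → p 2 → ∀ j, p j := by
    intro p _ _ _ j; fin_cases j <;> assumption
  have hself : ∀ (i : Fin 3) (p : Prop), i ≠ i → p := fun _ _ h => absurd rfl h
  by_cases h0 : simpleRoot 0 ∈ R <;> by_cases h1 : simpleRoot 1 ∈ R <;>
    by_cases h2 : simpleRoot 2 ∈ R
  · exact Set.inter_subset_right.trans (hnil _ (Set.sdiff_eq_empty.2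
      (hR.1.posRoots_subset (hfin _ h0 h1 h2))))
  · exact key 2 (Or.inr ⟨h2, hfin _ (fun _ => h0) (fun _ => h1) (hself _ _)⟩)
  · exact key 1 (Or.inr ⟨h1, hfin _ (fun _ => h0) (hself _ _) (fun _ => h2)⟩)
  · exact key 0 (Or.inl ⟨h0, hfin _ (hself _ _) (fun _ => h1) (fun _ => h2)⟩)
  · exact key 0 (Or.inr ⟨h0, hfin _ (hself _ _) (fun _ => h1) (fun _ => h2)⟩)
  · exact key 1 (Or.inl ⟨h1, hfin _ (fun _ => h0) (hself _ _) (fun _ => h2)⟩)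
  · exact key 2 (Or.inl ⟨h2, hfin _ (fun _ => h0) (fun _ => h1) (hself _ _)⟩)
  · refine Set.inter_subset_left.trans (hnil _ (Set.eq_empty_of_forall_notMem fun x hx => ?_))
    exact (hR.2.posRoots_subset (hfin _ ((hcompl 0).2 h0) ((hcompl 1).2 h1) ((hcompl 2).2 h2))
      (hR.subset hx)).2 hx

end UniversalCoxeter

theorem theoremA :
    (∀ R : Set UniversalCoxeter.V,
      UniversalCoxeter.IsBiclosed R → UniversalCoxeter.IsWeaklySeparable R) ∧
    UniversalCoxeter.IsLatticeOrder UniversalCoxeter.ExtendedWeakOrder :=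
  ⟨fun _ hR => ⟨hR.subset, hR.separated.antisymm (Set.singleton_subset_iff.2
    ⟨UniversalCoxeter.zero_mem_nonnegSpan _, UniversalCoxeter.zero_mem_nonnegSpan _⟩)⟩,
    UniversalCoxeter.isLatticeOrder_extendedWeakOrder fun _ hR => hR.separated⟩
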